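/- All graphs are finite, simple and undirected, and need not be connected. A \emph{cactus} is a graph in which every edge belongs to at most one cycle. The \emph{girth} of a graph is the length of its shortest cycle, and the \emph{cycle-distance} of a cactus is the least length of a path joining a vertex of one cycle to a vertex of a different cycle (a single common vertex of two different cycles counts as such a path, of length $0$). In the \emph{coloring game} on a graph $G$ with a given set of colors, Alice and Bob alternately, with Alice moving first, choose an uncolored vertex and give it a color that is not used on any of its neighbors. Alice wins if all vertices of $G$ eventually get colored; Bob wins if the game stops with an uncolored vertex left, because no uncolored vertex can be legally colored. The \emph{game chromatic number} $\chi_g(G)$ is the smallest number of colors for which Alice has a winning strategy. \textbf{Theorem.} For all integers $d, k \ge 0$ there is a cactus $G$ which contains a cycle and a path joining two different cycles (so that its girth and its cycle-distance are finite), such that $G$ has girth at least $k$, cycle-distance at least $d$, and $\chi_g(G) = 5$. -/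

import Mathlib

/-- `H` is a cycle of `G`: the subgraph traced out by a closed walk without repetition. -/
def IsCycleSubgraph {V : Type*} (G : SimpleGraph V) (H : G.Subgraph) : Prop :=
  ∃ (u : V) (p : G.Walk u u), p.IsCycle ∧ p.toSubgraph = H

/-- A cactus is a graph in which every edge belongs to at most one cycle
(connectedness is not required). -/
def IsCactus {V : Type*} (G : SimpleGraph V) : Prop :=
  ∀ H₁ H₂ : G.Subgraph, IsCycleSubgraph G H₁ → IsCycleSubgraph G H₂ →
    ∀ e : Sym2 V, e ∈ H₁.edgeSet → e ∈ H₂.edgeSet → H₁ = H₂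

/-- The cycle-distance: the least length of a path joining a vertex of a cycle to a vertex of a
different cycle. Two cycles that meet are joined by a path of length `0`; the value is `⊤` when
there is no path between two different cycles. -/
noncomputable def cycleDistance {V : Type*} (G : SimpleGraph V) : ℕ∞ :=
  sInf {n : ℕ∞ | ∃ H₁ H₂ : G.Subgraph, IsCycleSubgraph G H₁ ∧ IsCycleSubgraph G H₂ ∧ H₁ ≠ H₂ ∧
    ∃ u ∈ H₁.verts, ∃ v ∈ H₂.verts, ∃ p : G.Walk u v, p.IsPath ∧ n = (p.length : ℕ∞)}

/-- The two players of the coloring game. -/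
inductive Player : Type
  | alice
  | bob

open Classical in
/-- One move of the coloring game from the partial coloring `c` to the partial coloring `c'`
(`none` means uncolored): an uncolored vertex gets a color that none of its neighbors has. -/
def GameMove {V : Type*} (G : SimpleGraph V) {k : ℕ} (c c' : V → Option (Fin k)) : Prop :=
  ∃ (v : V) (a : Fin k), c v = none ∧ (∀ w, G.Adj v w → c w ≠ some a) ∧
    c' = Function.update c v (some a)

/-- `AliceWinsFrom G k t c`: in the coloring game on `G` with `k` colors, Alice has a winning
strategy from the partial coloring `c` when it is the turn of player `t`. Alice wins when all
vertices are colored; if the player to move has no move while some vertex is uncolored,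
Bob wins. -/
inductive AliceWinsFrom {V : Type*} (G : SimpleGraph V) (k : ℕ) :
    Player → (V → Option (Fin k)) → Prop
  | done (t : Player) (c : V → Option (Fin k)) (h : ∀ v, c v ≠ none) : AliceWinsFrom G k t c
  | aliceMove (c c' : V → Option (Fin k)) (hm : GameMove G c c')
      (h : AliceWinsFrom G k Player.bob c') : AliceWinsFrom G k Player.alice c
  | bobMove (c : V → Option (Fin k)) (hm : ∃ c', GameMove G c c')
      (h : ∀ c', GameMove G c c' → AliceWinsFrom G k Player.alice c') :
      AliceWinsFrom G k Player.bob c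

/-- Alice, who moves first, has a winning strategy in the coloring game on `G` with `k` colors. -/
def AliceWins {V : Type*} (G : SimpleGraph V) (k : ℕ) : Prop :=
  AliceWinsFrom G k Player.alice (fun _ => none)

/-- The game chromatic number of a finite graph: the least number of colors with which Alice
wins. -/
noncomputable def gameChromaticNumber {V : Type*} [Finite V] (G : SimpleGraph V) : ℕ :=
  sInf {k : ℕ | AliceWins G k}

/-! The witness is a path of eight hubs; at each hub hang eight lollipops (a tail ending in a long
odd cycle), and every vertex of this core gets many pendant leaves. The tails make the
cycle-distance large, the cycles the girth.

Lower bound. A leaf of an uncolored vertex `v` accepts every color, so with one move Bob takes any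
chosen color away from `v`. Split the four colors into two pairs. A vertex that sees a whole pair
must be colored from the other one. If the pairs seen by the two ends of an uncolored path do not
fit an alternation of the pairs, then any color that Alice puts on the path leaves a shorter path on
which Bob restores the same defect by blocking the partner of that color; if she plays elsewhere,
Bob closes up an end (`bob_wins_path`). An odd cycle can be traversed in two ways of opposite
parity, so in a lollipop whose end sees two colors Bob can force such a defect
(`bob_wins_lollipop'`). Hence an uncolored hub that sees two colors is lost with Bob to move, and
the path of hubs supplies enough double threats to get there (`not_aliceWins_corona`). Missing
colors count as blocked, so one argument covers every palette of at most four colors; no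
monotonicity in the number of colors is needed.

Upper bound. Deleting one edge from each cycle leaves a tree, and the deleted edges form a matching.
Alice keeps every uncolored vertex from having two children with colored vertices in their subtrees.
A move of Bob spoils this at one vertex at most, which she then colors. So an uncolored vertex never
has more than four colored neighbors: its parent, its partner and two children (`aliceWins_five`).
-/

namespace ColoringGame

open Sum

/-! ### Blocked colors and lost positions -/

section Basic

variable {V : Type*} {G : SimpleGraph V} {k : ℕ}

/-- An uncolored vertex `v` cannot legally get the color `a`; colors beyond the palette count
as blocked. -/
def Sees (G : SimpleGraph V) (c : V → Option (Fin k)) (v : V) (a : Fin 4) : Prop :=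
  ∀ b : Fin k, (b : ℕ) = a → ∃ w, G.Adj v w ∧ c w = some b

lemma gameMove_spec {c c' : V → Option (Fin k)} (h : GameMove G c c') :
    ∃ v a, c v = none ∧ (∀ w, G.Adj v w → c w ≠ some a) ∧ c' v = some a ∧
      ∀ u, u ≠ v → c' u = c u := by
  obtain ⟨v, a, h1, h2, rfl⟩ := h
  exact ⟨v, a, h1, h2, by simp, fun u hu => by simp [hu]⟩

lemma exists_gameMove {c : V → Option (Fin k)} {v : V} {a : Fin k} (h1 : c v = none)
    (h2 : ∀ w, G.Adj v w → c w ≠ some a) :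
    ∃ c', GameMove G c c' ∧ c' v = some a ∧ ∀ u, u ≠ v → c' u = c u := by
  classical
  refine ⟨_, ⟨v, a, h1, h2, rfl⟩, by simp, fun u hu => by simp [hu]⟩

lemma GameMove.colored {c c' : V → Option (Fin k)} (h : GameMove G c c') {v : V} {a : Fin k}
    (hv : c v = some a) : c' v = some a := by
  obtain ⟨x, b, h1, -, -, h4⟩ := gameMove_spec h
  rw [h4 v (by rintro rfl; simp [h1] at hv), hv]

lemma Sees.move {c c' : V → Option (Fin k)} {v : V} {a : Fin 4} (hs : Sees G c v a)
    (h : GameMove G c c') : Sees G c' v a := fun b hb => by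
  obtain ⟨w, hw, hc⟩ := hs b hb
  exact ⟨w, hw, GameMove.colored h hc⟩

lemma sees_of_adj (hk : k ≤ 4) {c : V → Option (Fin k)} {u x : V} {a : Fin k}
    (h : G.Adj u x) (hx : c x = some a) : Sees G c u (Fin.castLE hk a) := fun b hb => by
  have : b = a := Fin.ext (by simpa using hb)
  exact ⟨x, h, this ▸ hx⟩

lemma not_sees_of_legal (hk : k ≤ 4) {c : V → Option (Fin k)} {x : V} {a : Fin k}
    (h : ∀ w, G.Adj x w → c w ≠ some a) : ¬ Sees G c x (Fin.castLE hk a) := fun hs => by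
  obtain ⟨w, hw, hc⟩ := hs a (by simp)
  exact h w hw hc

/-- Colored vertices keep their colors, so a stuck vertex stays stuck in every continuation; the
induction runs over Alice's supposed strategy. -/
lemma not_aliceWinsFrom_of_stuck (hk : k ≤ 4) {c : V → Option (Fin k)} {t : Player} {v : V}
    (hv : c v = none) (hs : ∀ a, Sees G c v a) : ¬ AliceWinsFrom G k t c := by
  intro h
  have key : ∀ {c c' : V → Option (Fin k)}, GameMove G c c' → c v = none →
      (∀ a, Sees G c v a) → c' v = none := by
    intro c c' hm hv hs
    obtain ⟨x, b, h1, h2, h3, h4⟩ := gameMove_spec hm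
    by_cases hx : v = x
    · subst hx
      exact absurd (hs _) (not_sees_of_legal hk h2)
    · rw [h4 v hx, hv]
  induction h with
  | done t c h => exact h v hv
  | aliceMove c c' hm h ih => exact ih (key hm hv hs) (fun a => (hs a).move hm)
  | bobMove c hm h ih =>
    obtain ⟨c', hm⟩ := hm
    exact ih c' hm (key hm hv hs) (fun a => (hs a).move hm)

lemma not_aliceWinsFrom_bob {c c' : V → Option (Fin k)} (hm : GameMove G c c')
    (h : ¬ AliceWinsFrom G k Player.alice c') : ¬ AliceWinsFrom G k Player.bob c := by
  intro hw
  cases hw with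
  | done t c hd =>
    obtain ⟨x, b, h1, -⟩ := gameMove_spec hm
    exact hd x h1
  | bobMove c _ hall => exact h (hall c' hm)

lemma not_aliceWinsFrom_alice {c : V → Option (Fin k)} {v : V} (hv : c v = none)
    (h : ∀ c' x a, GameMove G c c' → c x = none → (∀ w, G.Adj x w → c w ≠ some a) →
      c' x = some a → (∀ u, u ≠ x → c' u = c u) → ¬ AliceWinsFrom G k Player.bob c') :
    ¬ AliceWinsFrom G k Player.alice c := by
  intro hw
  cases hw with
  | done t c hd => exact hd v hv
  | aliceMove c c' hm hb =>
    obtain ⟨x, a, h1, h2, h3, h4⟩ := gameMove_spec hm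
    exact h c' x a hm h1 h2 h3 h4 hb

end Basic

/-! ### Pendant vertices and alternating classes on paths -/

/-- The graph obtained from `G` by attaching `L` pendant vertices to every vertex. -/
def corona {K : Type*} (G : SimpleGraph K) (L : ℕ) : SimpleGraph (K ⊕ K × Fin L) where
  Adj
    | inl u, inl v => G.Adj u v
    | inl u, inr (v, _) => u = v
    | inr (u, _), inl v => u = v
    | inr _, inr _ => False
  symm := ⟨by
    rintro (u | ⟨u, i⟩) (v | ⟨v, j⟩) h
    · exact G.adj_symm h
    · exact h.symm
    · exact h.symm
    · exact h⟩
  loopless := ⟨by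
    rintro (u | ⟨u, i⟩) h
    · exact G.loopless.irrefl u h
    · exact h⟩

section Corona

variable {K : Type*} {G : SimpleGraph K} {L k : ℕ}

/-- Every vertex of the core still has `n` uncolored pendant neighbors. -/
def Fresh (c : K ⊕ K × Fin L → Option (Fin k)) (n : ℕ) : Prop :=
  ∀ v : K, n ≤ (Finset.univ.filter fun l : Fin L => c (inr (v, l)) = none).card

lemma Fresh.mono {c : K ⊕ K × Fin L → Option (Fin k)} {m n : ℕ} (h : Fresh c n) (hmn : m ≤ n) :
    Fresh c m := fun v => hmn.trans (h v)

lemma Fresh.move {c c' : K ⊕ K × Fin L → Option (Fin k)} {n : ℕ} (h : Fresh c (n + 1))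
    (hm : GameMove (corona G L) c c') : Fresh c' n := by
  intro v
  obtain ⟨x, b, h1, -, -, h4⟩ := gameMove_spec hm
  have key : ∀ l₀, (∀ l, l ≠ l₀ → (inr (v, l) : K ⊕ K × Fin L) ≠ x) →
      n ≤ (Finset.univ.filter fun l : Fin L => c' (inr (v, l)) = none).card := by
    intro l₀ hl
    have hsub : (Finset.univ.filter fun l : Fin L => c (inr (v, l)) = none).erase l₀ ⊆
        Finset.univ.filter fun l : Fin L => c' (inr (v, l)) = none := by
      intro l hl'
      simp only [Finset.mem_erase, Finset.mem_filter, Finset.mem_univ, true_and] at hl' ⊢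
      rw [h4 _ (hl l hl'.1), hl'.2]
    have := Finset.card_le_card hsub
    have := Finset.pred_card_le_card_erase
      (s := Finset.univ.filter fun l : Fin L => c (inr (v, l)) = none) (a := l₀)
    have := h v
    omega
  rcases x with x | ⟨x, l₀⟩
  · by_cases hL : Nonempty (Fin L)
    · exact key hL.some (fun l _ => by simp)
    · have := h v
      rw [Finset.univ_eq_empty_iff.mpr (not_nonempty_iff.mp hL)] at this
      simp at this
  · exact key l₀ (fun l hl => by simp [hl])

/-- Bob's basic move: the only neighbor of a leaf at `v` is `v` itself, which is uncolored, so every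
color is legal on that leaf. -/
lemma bob_blocks (hk0 : 0 < k) {c : K ⊕ K × Fin L → Option (Fin k)} {v : K} {n : ℕ}
    (hv : c (inl v) = none) (hf : Fresh c (n + 1)) (a : Fin 4)
    (h : ∀ c', GameMove (corona G L) c c' → (∀ u : K, c' (inl u) = c (inl u)) →
      Sees (corona G L) c' (inl v) a → Fresh c' n →
      ¬ AliceWinsFrom (corona G L) k Player.alice c') :
    ¬ AliceWinsFrom (corona G L) k Player.bob c := by
  obtain ⟨l, hl⟩ : ∃ l, c (inr (v, l)) = none := by
    have := hf v
    obtain ⟨l, hl⟩ := Finset.card_pos.mp (show 0 < (Finset.univ.filter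
      fun l : Fin L => c (inr (v, l)) = none).card by omega)
    exact ⟨l, by simpa using hl⟩
  have legal : ∀ b : Fin k, ∀ w, (corona G L).Adj (inr (v, l)) w → c w ≠ some b := by
    rintro b (w | w) hw
    · have : v = w := hw
      subst this
      simp [hv]
    · exact hw.elim
  have go : ∀ b : Fin k, (∀ b' : Fin k, (b' : ℕ) = a → b' = b) →
      ¬ AliceWinsFrom (corona G L) k Player.bob c := by
    intro b hb
    obtain ⟨c', hm, h1, h2⟩ := exists_gameMove (G := corona G L) hl (legal b)
    refine not_aliceWinsFrom_bob hm (h c' hm (fun u => h2 _ (by simp)) ?_ (hf.move hm))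
    intro b' hb'
    exact ⟨inr (v, l), rfl, (hb b' hb') ▸ h1⟩
  by_cases ha : (a : ℕ) < k
  · exact go ⟨a, ha⟩ (fun b' hb' => Fin.ext hb')
  -- A color outside the palette is blocked already; Bob wastes a move on the leaf.
  · exact go ⟨0, hk0⟩ (fun b' hb' => absurd b'.2 (by omega))

/-- A 2-coloring `φ mod 2` of the palette, both classes of which have at most two elements. -/
def IsPairing (φ : Fin 4 → ℕ) : Prop :=
  ∀ a, ∃ a', φ a' % 2 = φ a % 2 ∧ ∀ b, φ b % 2 = φ a % 2 → b = a ∨ b = a'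

/-- The vertex `v` sees all colors of the class `p`. -/
def SeesClass (G : SimpleGraph K) (φ : Fin 4 → ℕ) (c : K ⊕ K × Fin L → Option (Fin k)) (v : K)
    (p : ℕ) : Prop :=
  ∀ a, φ a % 2 = p % 2 → Sees (corona G L) c (inl v) a

lemma SeesClass.move {φ : Fin 4 → ℕ} {c c' : K ⊕ K × Fin L → Option (Fin k)} {v : K} {p : ℕ}
    (h : SeesClass G φ c v p) (hm : GameMove (corona G L) c c') : SeesClass G φ c' v p :=
  fun a ha => (h a ha).move hm

/-- A class has at most two colors, so once one of them is seen a single block finishes the class.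
-/
lemma bob_completes_class (hk0 : 0 < k) {φ : Fin 4 → ℕ} (hφ : IsPairing φ)
    {c : K ⊕ K × Fin L → Option (Fin k)} {v : K} {n p : ℕ} {g : Fin 4}
    (hv : c (inl v) = none) (hf : Fresh c (n + 1)) (hs : Sees (corona G L) c (inl v) g)
    (hg : φ g % 2 = p % 2)
    (h : ∀ c', GameMove (corona G L) c c' → (∀ u : K, c' (inl u) = c (inl u)) →
      SeesClass G φ c' v p → Fresh c' n → ¬ AliceWinsFrom (corona G L) k Player.alice c') :
    ¬ AliceWinsFrom (corona G L) k Player.bob c := by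
  obtain ⟨g', -, hg'⟩ := hφ g
  refine bob_blocks hk0 hv hf g' (fun c' hm h1 h2 h3 => h c' hm h1 ?_ h3)
  intro a ha
  rcases hg' a (ha.trans hg.symm) with rfl | rfl
  · exact hs.move hm
  · exact h2

/-- Bob wins when both ends of an uncolored path see a class of colors such that the classes
alternate along the path, with a mismatch. -/
theorem bob_wins_path (hk : k ≤ 4) (hk0 : 0 < k) {φ : Fin 4 → ℕ} (hφ : IsPairing φ) (f : ℕ → K) :
    ∀ (n lo p : ℕ) (c : K ⊕ K × Fin L → Option (Fin k)),
    (∀ i, lo ≤ i → i < lo + n → G.Adj (f i) (f (i + 1))) →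
    Set.InjOn f (Set.Icc lo (lo + n)) →
    (∀ i, lo ≤ i → i ≤ lo + n → c (inl (f i)) = none) →
    SeesClass G φ c (f lo) p → SeesClass G φ c (f (lo + n)) (p + n + 1) →
    Fresh c (4 * n + 4) → ¬ AliceWinsFrom (corona G L) k Player.alice c := by
  -- At most four moves pass before the path loses a vertex (Alice elsewhere, Bob, Alice, Bob),
  -- whence the reserve of `4 * n + 4` leaves.
  intro n
  induction n using Nat.strong_induction_on with
  | _ n ih =>
  -- Alice colors a vertex of the path
  have key : ∀ (lo p : ℕ) (c c' : K ⊕ K × Fin L → Option (Fin k)) (i : ℕ) (g : Fin k),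
      (∀ i, lo ≤ i → i < lo + n → G.Adj (f i) (f (i + 1))) →
      Set.InjOn f (Set.Icc lo (lo + n)) →
      (∀ i, lo ≤ i → i ≤ lo + n → c (inl (f i)) = none) →
      SeesClass G φ c (f lo) p → SeesClass G φ c (f (lo + n)) (p + n + 1) →
      Fresh c (4 * n + 2) → GameMove (corona G L) c c' → lo ≤ i → i ≤ lo + n →
      (∀ w, (corona G L).Adj (inl (f i)) w → c w ≠ some g) →
      c' (inl (f i)) = some g → (∀ u, u ≠ inl (f i) → c' u = c u) →
      ¬ AliceWinsFrom (corona G L) k Player.bob c' := by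
    intro lo p c c' i g hadj hinj hun hlo hhi hf hm hi1 hi2 hleg hg hoth
    have hns := not_sees_of_legal hk hleg
    have hf' : Fresh c' (4 * n + 1) := hf.move hm
    have hun' : ∀ j, lo ≤ j → j ≤ lo + n → j ≠ i → c' (inl (f j)) = none := by
      intro j h1 h2 h3
      rw [hoth _ (fun h => h3 (hinj ⟨h1, h2⟩ ⟨hi1, hi2⟩ (inl.inj h))), hun j h1 h2]
    by_cases hcase : lo < i ∧ φ (Fin.castLE hk g) % 2 = (p + (i - lo)) % 2
    -- The color has the class `p + (i - lo)`, so the part before `f i` inherits the mismatch: Bob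
    -- completes this class at `f (i - 1)`.
    · obtain ⟨hlt, hph⟩ := hcase
      have hs : Sees (corona G L) c' (inl (f (i - 1))) (Fin.castLE hk g) := by
        refine sees_of_adj hk (x := inl (f i)) ?_ hg
        have := hadj (i - 1) (by omega) (by omega)
        rwa [Nat.sub_add_cancel (by omega)] at this
      refine bob_completes_class hk0 hφ (p := p + (i - lo)) (n := 4 * n)
        (hun' (i - 1) (by omega) (by omega) (by omega)) hf' hs hph ?_
      intro c'' hm' hco hcl hf''
      refine ih (i - 1 - lo) (by omega) lo p c'' (fun j h1 h2 => hadj j h1 (by omega))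
        (hinj.mono (Set.Icc_subset_Icc le_rfl (by omega)))
        (fun j h1 h2 => by rw [hco]; exact hun' j h1 (by omega) (by omega))
        ((hlo.move hm).move hm') ?_ (hf''.mono (by omega))
      rw [show lo + (i - 1 - lo) = i - 1 by omega,
        show p + (i - 1 - lo) + 1 = p + (i - lo) by omega]
      exact hcl
    -- With the other class the mismatch passes to the part after `f i`. At `i = lo` this is the
    -- only legal class, and at `i = lo + n` it is illegal, so that part is nonempty.
    · have hph : φ (Fin.castLE hk g) % 2 = (p + (i - lo) + 1) % 2 := by
        by_cases hlt : lo < i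
        · have : ¬ φ (Fin.castLE hk g) % 2 = (p + (i - lo)) % 2 := fun h => hcase ⟨hlt, h⟩
          omega
        · have hil : i = lo := by omega
          subst hil
          have : ¬ φ (Fin.castLE hk g) % 2 = p % 2 := fun h => hns (hlo _ h)
          omega
      have hlt : i < lo + n := by
        by_contra hge
        have hil : i = lo + n := by omega
        subst hil
        exact hns (hhi _ (by omega))
      have hs : Sees (corona G L) c' (inl (f (i + 1))) (Fin.castLE hk g) :=
        sees_of_adj hk (x := inl (f i)) (hadj i hi1 hlt).symm hg
      refine bob_completes_class hk0 hφ (p := p + (i - lo) + 1) (n := 4 * n)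
        (hun' (i + 1) (by omega) (by omega) (by omega)) hf' hs hph ?_
      intro c'' hm' hco hcl hf''
      refine ih (lo + n - (i + 1)) (by omega) (i + 1) (p + (i - lo) + 1) c''
        (fun j h1 h2 => hadj j (by omega) (by omega))
        (hinj.mono (Set.Icc_subset_Icc (by omega) (by omega)))
        (fun j h1 h2 => by rw [hco]; exact hun' j (by omega) (by omega) (by omega))
        hcl ?_ (hf''.mono (by omega))
      rw [show i + 1 + (lo + n - (i + 1)) = lo + n by omega]
      intro a ha
      exact (((hhi a (by omega)).move hm).move hm')
  intro lo p c hadj hinj hun hlo hhi hf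
  have hlo0 := hun lo le_rfl (by omega)
  by_cases hex : ∃ a, φ a % 2 = (p + 1) % 2
  swap
  -- If the opposite class is empty, `f lo` sees all four colors already.
  · refine not_aliceWinsFrom_of_stuck hk hlo0 (fun a => hlo a ?_)
    by_contra hne
    exact hex ⟨a, by omega⟩
  obtain ⟨a, ha⟩ := hex
  refine not_aliceWinsFrom_alice hlo0 ?_
  intro c₁ x g hm1 hx hleg hg hoth
  by_cases hxp : ∃ i, lo ≤ i ∧ i ≤ lo + n ∧ x = inl (f i)
  · obtain ⟨i, hi1, hi2, rfl⟩ := hxp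
    exact key lo p c c₁ i g hadj hinj hun hlo hhi (hf.mono (by omega)) hm1 hi1 hi2 hleg hg hoth
  have hun1 : ∀ i, lo ≤ i → i ≤ lo + n → c₁ (inl (f i)) = none := by
    intro i h1 h2
    rw [hoth _ (fun h => hxp ⟨i, h1, h2, h.symm⟩), hun i h1 h2]
  have hf1 : Fresh c₁ (4 * n + 3) := hf.move hm1
  -- Alice played off the path. Bob blocks one color of the opposite class at `f lo`; if she ignores
  -- the path again, he blocks the other one and `f lo` is stuck.
  refine bob_blocks hk0 (hun1 lo le_rfl (by omega)) hf1 a ?_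
  intro c₂ hm2 hco2 hs2 hf2
  have hun2 : ∀ i, lo ≤ i → i ≤ lo + n → c₂ (inl (f i)) = none := by
    intro i h1 h2
    rw [hco2, hun1 i h1 h2]
  have hlo2 := (hlo.move hm1).move hm2
  have hhi2 := (hhi.move hm1).move hm2
  refine not_aliceWinsFrom_alice (hun2 lo le_rfl (by omega)) ?_
  intro c₃ x g hm3 hx hleg hg hoth
  by_cases hxp : ∃ i, lo ≤ i ∧ i ≤ lo + n ∧ x = inl (f i)
  · obtain ⟨i, hi1, hi2, rfl⟩ := hxp
    exact key lo p c₂ c₃ i g hadj hinj hun2 hlo2 hhi2 (hf2.mono (by omega)) hm3 hi1 hi2 hleg hg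
      hoth
  have hun3 : c₃ (inl (f lo)) = none := by
    rw [hoth _ (fun h => hxp ⟨lo, le_rfl, by omega, h.symm⟩), hun2 lo le_rfl (by omega)]
  have hf3 : Fresh c₃ (4 * n + 1) := hf2.move hm3
  refine bob_completes_class hk0 hφ (p := p + 1) hun3 hf3 (hs2.move hm3) ha ?_
  intro c₄ hm4 hco4 hcl hf4
  refine not_aliceWinsFrom_of_stuck hk (v := inl (f lo)) (by rw [hco4, hun3]) (fun b => ?_)
  by_cases hb : φ b % 2 = p % 2
  · exact ((hlo2.move hm3).move hm4) b hb
  · exact hcl b (by omega)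

/-- Bob, to move, wins when one end of an uncolored path sees a class of colors and the other end
one color of the fitting class. -/
theorem bob_wins_path' (hk : k ≤ 4) (hk0 : 0 < k) {φ : Fin 4 → ℕ} (hφ : IsPairing φ) (f : ℕ → K)
    {n lo p : ℕ} {c : K ⊕ K × Fin L → Option (Fin k)} {g : Fin 4}
    (hadj : ∀ i, lo ≤ i → i < lo + n → G.Adj (f i) (f (i + 1)))
    (hinj : Set.InjOn f (Set.Icc lo (lo + n)))
    (hun : ∀ i, lo ≤ i → i ≤ lo + n → c (inl (f i)) = none)
    (hlo : SeesClass G φ c (f lo) p) (hhi : Sees (corona G L) c (inl (f (lo + n))) g)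
    (hg : φ g % 2 = (p + n + 1) % 2) (hf : Fresh c (4 * n + 5)) :
    ¬ AliceWinsFrom (corona G L) k Player.bob c := by
  refine bob_completes_class hk0 hφ (p := p + n + 1) (n := 4 * n + 4) (hun _ (by omega) le_rfl)
    hf hhi hg ?_
  intro c' hm hco hcl hf'
  exact bob_wins_path hk hk0 hφ f n lo p c' hadj hinj (fun i h1 h2 => by rw [hco, hun i h1 h2])
    (hlo.move hm) hcl hf'

end Corona

/-! ### Lollipops with an odd cycle -/

section Lollipop

variable {K : Type*} {G : SimpleGraph K} {L k : ℕ}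

/-- The pairing of the palette with the class `{a, b}`. -/
def pairing (a b x : Fin 4) : ℕ := if x = a ∨ x = b then 0 else 1

lemma isPairing_pairing {a b : Fin 4} (h : a ≠ b) : IsPairing (pairing a b) := by
  unfold IsPairing pairing
  revert a b
  decide

lemma exists_pairing_mod {a b : Fin 4} (h : a ≠ b) (n : ℕ) :
    ∃ x, pairing a b x % 2 = n % 2 := by
  have h2 : ∀ a b : Fin 4, a ≠ b → ∃ x, pairing a b x = 1 := by
    unfold pairing
    decide
  rcases Nat.mod_two_eq_zero_or_one n with hn | hn
  · exact ⟨a, by simp [pairing, hn]⟩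
  · obtain ⟨x, hx⟩ := h2 a b h
    exact ⟨x, by rw [hx, hn]⟩

lemma seesClass_pairing {a b : Fin 4} {c : K ⊕ K × Fin L → Option (Fin k)} {v : K} {p : ℕ}
    (hp : p % 2 = 0) (ha : Sees (corona G L) c (inl v) a) (hb : Sees (corona G L) c (inl v) b) :
    SeesClass G (pairing a b) c v p := by
  intro x hx
  unfold pairing at hx
  split_ifs at hx with h
  · rcases h with rfl | rfl
    · exact ha
    · exact hb
  · omega

/-- The vertices `f lo, …, f t` form a path, and `f t, …, f (t + m - 1)` form a cycle. -/
structure IsLollipop (G : SimpleGraph K) (f : ℕ → K) (lo t m : ℕ) : Prop where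
  le : lo ≤ t
  adj : ∀ i, lo ≤ i → i + 1 < t + m → G.Adj (f i) (f (i + 1))
  closing : G.Adj (f (t + m - 1)) (f t)
  inj : Set.InjOn f (Set.Ico lo (t + m))

lemma IsLollipop.tail {f : ℕ → K} {lo lo' t m : ℕ} (h : IsLollipop G f lo t m) (h1 : lo ≤ lo')
    (h2 : lo' ≤ t) : IsLollipop G f lo' t m :=
  ⟨h2, fun i hi => h.adj i (h1.trans hi), h.closing,
    h.inj.mono (Set.Ico_subset_Ico h1 le_rfl)⟩

/-- Traversing the cycle of a lollipop in the opposite direction. -/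
def turn (f : ℕ → K) (t m i : ℕ) : K := if i ≤ t then f i else f (2 * t + m - i)

lemma IsLollipop.turn {f : ℕ → K} {lo t m : ℕ} (hm : 3 ≤ m) (h : IsLollipop G f lo t m) :
    IsLollipop G (turn f t m) lo t m := by
  refine ⟨h.le, fun i hi hi' => ?_, ?_, ?_⟩
  · unfold ColoringGame.turn
    rcases lt_trichotomy i t with hlt | rfl | hgt
    · rw [if_pos hlt.le, if_pos (by omega)]
      exact h.adj i hi hi'
    · rw [if_pos le_rfl, if_neg (by omega), show 2 * i + m - (i + 1) = i + m - 1 by omega]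
      exact h.closing.symm
    · rw [if_neg (by omega), if_neg (by omega),
        show 2 * t + m - i = (2 * t + m - (i + 1)) + 1 by omega]
      exact (h.adj _ (by have := h.le; omega) (by omega)).symm
  · unfold ColoringGame.turn
    rw [if_neg (by omega), if_pos le_rfl, show 2 * t + m - (t + m - 1) = t + 1 by omega]
    exact (h.adj t h.le (by omega)).symm
  · intro i hi j hj hij
    have hle := h.le
    simp only [Set.mem_Ico] at hi hj
    unfold ColoringGame.turn at hij
    have key : ∀ a b, lo ≤ a → a < t + m → lo ≤ b → b < t + m → f a = f b → a = b :=
      fun a b h1 h2 h3 h4 h5 => h.inj ⟨h1, h2⟩ ⟨h3, h4⟩ h5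
    split_ifs at hij <;> have := key _ _ (by omega) (by omega) (by omega) (by omega) hij <;> omega

/-- Bob wins with Alice to move when the end `f lo` of an uncolored lollipop with an odd cycle
sees a class of colors and the vertex `f (t + 1)` of the cycle sees a color of the fitting
class. -/
theorem bob_wins_lollipop (hk : k ≤ 4) (hk0 : 0 < k) {f : ℕ → K} {t m : ℕ} (hm3 : 3 ≤ m)
    (hodd : m % 2 = 1) {g : Fin 4} {φ : Fin 4 → ℕ} (hφ : IsPairing φ) :
    ∀ (r lo p : ℕ) (c : K ⊕ K × Fin L → Option (Fin k)), lo + r = t →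
    IsLollipop G f lo t m → (∀ i, lo ≤ i → i < t + m → c (inl (f i)) = none) →
    SeesClass G φ c (f lo) p → Sees (corona G L) c (inl (f (t + 1))) g →
    φ g % 2 = (p + r) % 2 → Fresh c (4 * (t + m) + 2 * r + 8) →
    ¬ AliceWinsFrom (corona G L) k Player.alice c := by
  intro r
  induction r using Nat.strong_induction_on with
  | _ r ih =>
  intro lo p c hr hl hun hlo hw hg hf
  refine not_aliceWinsFrom_alice (hun lo le_rfl (by omega)) ?_
  intro c' x e hm hx hleg he hoth
  have hf' : Fresh c' (4 * (t + m) + 2 * r + 7) := hf.move hm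
  have hlo' := hlo.move hm
  by_cases hxl : ∃ i, lo ≤ i ∧ i < t + m ∧ x = inl (f i)
  swap
  · have hun' : ∀ i, lo ≤ i → i < t + m → c' (inl (f i)) = none := by
      intro i h1 h2
      rw [hoth _ (fun h => hxl ⟨i, h1, h2, h.symm⟩), hun i h1 h2]
    -- The standing threat: the path from `f lo` to `f (t + 1)` has `r + 1` edges, and `g` lies in
    -- the class needed at its far end.
    refine bob_wins_path' hk hk0 hφ f (n := r + 1) (g := g)
      (fun i h1 h2 => hl.adj i h1 (by omega))
      (hl.inj.mono (Set.Icc_subset_Ico_right (by omega)))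
      (fun i h1 h2 => hun' i h1 (by omega)) hlo' ?_ (by omega) (hf'.mono (by omega))
    rw [show lo + (r + 1) = t + 1 by omega]
    exact hw.move hm
  obtain ⟨i, hi1, hi2, rfl⟩ := hxl
  have hns := not_sees_of_legal hk hleg
  have hun' : ∀ j, lo ≤ j → j < t + m → j ≠ i → c' (inl (f j)) = none := by
    intro j h1 h2 h3
    rw [hoth _ (fun h => h3 (hl.inj ⟨h1, h2⟩ ⟨hi1, hi2⟩ (inl.inj h))), hun j h1 h2]
  have hsee : ∀ u, G.Adj u (f i) → Sees (corona G L) c' (inl u) (Fin.castLE hk e) :=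
    fun u hu => sees_of_adj hk (G := corona G L) (u := inl u) (x := inl (f i)) hu he
  -- the segment before the vertex colored by Alice
  by_cases hcase : lo < i ∧ φ (Fin.castLE hk e) % 2 = (p + (i - lo)) % 2
  · obtain ⟨hlt, hph⟩ := hcase
    refine bob_wins_path' hk hk0 hφ f (n := i - 1 - lo) (g := Fin.castLE hk e)
      (fun j h1 h2 => hl.adj j h1 (by omega))
      (hl.inj.mono (Set.Icc_subset_Ico_right (by omega)))
      (fun j h1 h2 => hun' j h1 (by omega) (by omega)) hlo' ?_ (by omega) (hf'.mono (by omega))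
    rw [show lo + (i - 1 - lo) = i - 1 by omega]
    refine hsee _ ?_
    have := hl.adj (i - 1) (by omega) (by omega)
    rwa [Nat.sub_add_cancel (by omega)] at this
  have hph : φ (Fin.castLE hk e) % 2 = (p + (i - lo) + 1) % 2 := by
    by_cases hlt : lo < i
    · have : ¬ φ (Fin.castLE hk e) % 2 = (p + (i - lo)) % 2 := fun h => hcase ⟨hlt, h⟩
      omega
    · have hil : i = lo := by omega
      subst hil
      have : ¬ φ (Fin.castLE hk e) % 2 = p % 2 := fun h => hns (hlo _ h)
      omega
  rcases lt_trichotomy i t with hit | rfl | hit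
  · -- Alice colors a vertex of the tail
    refine bob_completes_class hk0 hφ (p := p + (i - lo) + 1) (v := f (i + 1))
      (hun' (i + 1) (by omega) (by omega) (by omega)) hf'
      (hsee _ (hl.adj i hi1 (by omega)).symm) hph ?_
    intro c'' hm' hco hcl hf''
    exact ih (r - (i + 1 - lo)) (by omega) (i + 1) (p + (i - lo) + 1) c'' (by omega)
      (hl.tail (by omega) (by omega))
      (fun j h1 h2 => by rw [hco]; exact hun' j (by omega) h2 (by omega)) hcl
      ((hw.move hm).move hm') (by omega) (hf''.mono (by omega))
  · -- Alice colors the attachment vertex of the cycle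
    -- Now `f (t + 1)` sees both `g` and `e`, which lie in different classes. Bob changes to the
    -- pairing with class `{g, e}` and uses the rest of the cycle: it has `m - 2` edges, an odd
    -- number, so the mismatch needs that same class at the last vertex, which sees `e`.
    have hne : g ≠ Fin.castLE hk e := by
      rintro rfl
      omega
    refine bob_wins_path' hk hk0 (isPairing_pairing hne) f (n := m - 2) (lo := i + 1) (p := 0)
      (g := Fin.castLE hk e) (fun j h1 h2 => hl.adj j (by omega) (by omega))
      (hl.inj.mono fun j hj => by simp only [Set.mem_Icc, Set.mem_Ico] at hj ⊢; omega)
      (fun j h1 h2 => hun' j (by omega) (by omega) (by omega))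
      (seesClass_pairing rfl (hw.move hm) (hsee _ (hl.adj i hi1 (by omega)).symm)) ?_ ?_
      (hf'.mono (by omega))
    · rw [show i + 1 + (m - 2) = i + m - 1 by omega]
      exact hsee _ hl.closing
    · simp only [pairing, or_true, if_true]
      omega
  · -- Alice colors another vertex of the cycle
    -- The color has the wrong parity for the route from `f t` upwards. Since `m` is odd, it has the
    -- right one for the route around the other side, which ends at the other neighbor of `f i`.
    have hl' := hl.turn hm3
    have hidx : ∀ j, lo ≤ j → j ≤ 2 * t + m - 1 - i →
        ∃ j', lo ≤ j' ∧ j' < t + m ∧ j' ≠ i ∧ turn f t m j = f j' := by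
      intro j h1 h2
      unfold turn
      split_ifs with h
      · exact ⟨j, h1, by omega, by omega, rfl⟩
      · exact ⟨_, by omega, by omega, by omega, rfl⟩
    refine bob_wins_path' hk hk0 hφ (turn f t m) (n := 2 * t + m - 1 - i - lo)
      (g := Fin.castLE hk e) (fun j h1 h2 => hl'.adj j h1 (by omega))
      (hl'.inj.mono (Set.Icc_subset_Ico_right (by omega)))
      (fun j h1 h2 => ?_) (by rwa [show turn f t m lo = f lo from if_pos hl.le]) ?_ (by omega)
      (hf'.mono (by omega))
    · obtain ⟨j', h3, h4, h5, h6⟩ := hidx j h1 (by omega)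
      rw [h6, hun' j' h3 h4 h5]
    · rw [show lo + (2 * t + m - 1 - i - lo) = 2 * t + m - 1 - i by omega]
      refine hsee _ ?_
      unfold turn
      split_ifs with h
      · have : i = t + m - 1 := by omega
        subst this
        rw [show 2 * t + m - 1 - (t + m - 1) = t by omega]
        exact hl.closing.symm
      · rw [show 2 * t + m - (2 * t + m - 1 - i) = i + 1 by omega]
        exact (hl.adj i hi1 (by omega)).symm

/-- Bob, to move, wins when the end of an uncolored lollipop with an odd cycle sees two colors. -/
theorem bob_wins_lollipop' (hk : k ≤ 4) (hk0 : 0 < k) {f : ℕ → K} {lo t m : ℕ} (hm3 : 3 ≤ m)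
    (hodd : m % 2 = 1) {a b : Fin 4} (hab : a ≠ b) {c : K ⊕ K × Fin L → Option (Fin k)}
    (hl : IsLollipop G f lo t m) (hun : ∀ i, lo ≤ i → i < t + m → c (inl (f i)) = none)
    (ha : Sees (corona G L) c (inl (f lo)) a) (hb : Sees (corona G L) c (inl (f lo)) b)
    (hf : Fresh c (4 * (t + m) + 2 * t + 9)) :
    ¬ AliceWinsFrom (corona G L) k Player.bob c := by
  have hle := hl.le
  obtain ⟨g, hg⟩ := exists_pairing_mod hab (0 + (t - lo))
  -- Bob sets up the threat of `bob_wins_lollipop` beyond the attachment vertex.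
  refine bob_blocks hk0 (hun (t + 1) (by omega) (by omega)) hf g ?_
  intro c' hm hco hs hf'
  exact bob_wins_lollipop hk hk0 hm3 hodd (isPairing_pairing hab) (t - lo) lo 0 c' (by omega) hl
    (fun i h1 h2 => by rw [hco, hun i h1 h2]) ((seesClass_pairing rfl ha hb).move hm) hs hg
    (hf'.mono (by omega))

end Lollipop

/-! ### The path of hubs and Bob's strategy with at most four colors -/

section Construction

/-- Eight hubs, each with `J` arms of `s` vertices. -/
abbrev Core (J s : ℕ) : Type := Fin 8 ⊕ (Fin 8 × Fin J × Fin s)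

/-- The second vertex is the parent of the first one in the spanning tree of the core. -/
def CoreParent {J s : ℕ} : Core J s → Core J s → Prop
  | inl h, inl h' => (h : ℕ) = h' + 1
  | inr (h, _, i), inl h' => h = h' ∧ (i : ℕ) = 0
  | inr (h, j, i), inr (h', j', i') => h = h' ∧ j = j' ∧ (i : ℕ) = i' + 1
  | inl _, inr _ => False

/-- The edge that joins the end of an arm to its vertex with index `t`. -/
def CoreChord {J s : ℕ} (t : ℕ) : Core J s → Core J s → Prop
  | inr (h, j, i), inr (h', j', i') => h = h' ∧ j = j' ∧ (i : ℕ) = t ∧ (i' : ℕ) + 1 = s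
  | _, _ => False

/-- A path of hubs, with a lollipop hanging at each hub for each of its arms. -/
def coreGraph (J s t : ℕ) : SimpleGraph (Core J s) :=
  SimpleGraph.fromRel fun u v => CoreParent u v ∨ CoreChord t u v

variable {J s t : ℕ}

lemma coreGraph_adj {u v : Core J s} : (coreGraph J s t).Adj u v ↔
    u ≠ v ∧ (CoreParent u v ∨ CoreChord t u v ∨ CoreParent v u ∨ CoreChord t v u) := by
  simp only [coreGraph, SimpleGraph.fromRel_adj]
  tauto

lemma hub_adj {h h' : Fin 8} (hh : (h : ℕ) = h' + 1) :
    (coreGraph J s t).Adj (inl h) (inl h') :=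
  coreGraph_adj.mpr ⟨fun e => by rw [inl.inj e] at hh; omega, Or.inl hh⟩

/-- The vertices of an arm, preceded by its hub. -/
def armFun [NeZero s] (h : Fin 8) (j : Fin J) : ℕ → Core J s
  | 0 => inl h
  | i + 1 => inr (h, j, Fin.ofNat s i)

lemma isLollipop_armFun [NeZero s] (hst : t + 3 ≤ s) (h : Fin 8) (j : Fin J) :
    IsLollipop (coreGraph J s t) (armFun h j) 0 (t + 1) (s - t) := by
  -- The hub takes index `0`, so arm indices shift by one and the cycle starts at `t + 1`.
  have hv : ∀ i, i < s → ((Fin.ofNat s i : Fin s) : ℕ) = i := fun i hi => Nat.mod_eq_of_lt hi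
  refine ⟨by omega, fun i _ hi => SimpleGraph.Adj.symm ?_, ?_, ?_⟩
  · rcases i with _ | i
    · refine coreGraph_adj.mpr ⟨by simp [armFun], Or.inl ⟨rfl, hv 0 (by omega)⟩⟩
    · have h1 := hv i (by omega)
      have h2 := hv (i + 1) (by omega)
      refine coreGraph_adj.mpr ⟨fun e => ?_, Or.inl ⟨rfl, rfl, by rw [h1, h2]⟩⟩
      have := congrArg Fin.val (Prod.ext_iff.mp (Prod.ext_iff.mp (inr.inj e)).2).2
      simp only at this
      omega
  · rw [show t + 1 + (s - t) - 1 = (s - 1) + 1 by omega]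
    have h1 := hv (s - 1) (by omega)
    have h2 := hv t (by omega)
    refine coreGraph_adj.mpr ⟨fun e => ?_, Or.inr (Or.inr (Or.inr ⟨rfl, rfl, h2, by omega⟩))⟩
    have := congrArg Fin.val (Prod.ext_iff.mp (Prod.ext_iff.mp (inr.inj e)).2).2
    simp only at this
    omega
  · rintro (_ | a) ha (_ | b) hb hab
    · rfl
    · simp [armFun] at hab
    · simp [armFun] at hab
    · have := congrArg Fin.val (Prod.ext_iff.mp (Prod.ext_iff.mp (inr.inj hab)).2).2
      simp only [Set.mem_Ico] at this ha hb
      rw [hv a (by omega), hv b (by omega)] at this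
      omega

variable {L k : ℕ}

/-- At least `n` arms of the hub `h` are uncolored. -/
def Intact (c : Core J s ⊕ Core J s × Fin L → Option (Fin k)) (h : Fin 8) (n : ℕ) : Prop :=
  n ≤ (Finset.univ.filter fun j : Fin J => ∀ i, c (inl (inr (h, j, i))) = none).card

lemma Intact.mono {c : Core J s ⊕ Core J s × Fin L → Option (Fin k)} {h : Fin 8} {m n : ℕ}
    (hi : Intact c h n) (hmn : m ≤ n) : Intact c h m := hmn.trans hi

lemma Intact.move {c c' : Core J s ⊕ Core J s × Fin L → Option (Fin k)} {h : Fin 8} {n : ℕ}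
    (hi : Intact c h (n + 1)) (hm : GameMove (corona (coreGraph J s t) L) c c') :
    Intact c' h n := by
  obtain ⟨x, b, h1, -, -, h4⟩ := gameMove_spec hm
  have key : ∀ j₀, (∀ j i, j ≠ j₀ →
      (inl (inr (h, j, i)) : Core J s ⊕ Core J s × Fin L) ≠ x) → Intact c' h n := by
    intro j₀ hl
    have hsub : (Finset.univ.filter fun j : Fin J =>
        ∀ i, c (inl (inr (h, j, i))) = none).erase j₀ ⊆
        Finset.univ.filter fun j : Fin J => ∀ i, c' (inl (inr (h, j, i))) = none := by
      intro j hj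
      simp only [Finset.mem_erase, Finset.mem_filter, Finset.mem_univ, true_and] at hj ⊢
      intro i
      rw [h4 _ (hl j i hj.1), hj.2]
    have := Finset.card_le_card hsub
    have := Finset.pred_card_le_card_erase
      (s := Finset.univ.filter fun j : Fin J => ∀ i, c (inl (inr (h, j, i))) = none) (a := j₀)
    unfold Intact at hi ⊢
    omega
  obtain ⟨j₁, -⟩ : ∃ j : Fin J, j ∈ Finset.univ.filter
      fun j : Fin J => ∀ i, c (inl (inr (h, j, i))) = none :=
    Finset.card_pos.mp (by unfold Intact at hi; omega)
  rcases x with (x | ⟨_, j₀, _⟩) | x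
  · exact key j₁ (fun j i _ => by simp)
  · exact key j₀ (fun j i hj => by simp [hj])
  · exact key j₁ (fun j i _ => by simp)

/-- Bob, to move, wins when an uncolored hub with an uncolored arm sees two colors. -/
theorem bob_wins_hub (hk : k ≤ 4) (hk0 : 0 < k) (hst : t + 3 ≤ s) (hodd : (s - t) % 2 = 1)
    {c : Core J s ⊕ Core J s × Fin L → Option (Fin k)} {h : Fin 8} {a b : Fin 4} (hab : a ≠ b)
    (hh : c (inl (inl h)) = none) (hi : Intact c h 1)
    (ha : Sees (corona (coreGraph J s t) L) c (inl (inl h)) a)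
    (hb : Sees (corona (coreGraph J s t) L) c (inl (inl h)) b) (hf : Fresh c (6 * s + 15)) :
    ¬ AliceWinsFrom (corona (coreGraph J s t) L) k Player.bob c := by
  have : NeZero s := ⟨by omega⟩
  obtain ⟨j, hj⟩ := Finset.card_pos.mp (Nat.lt_of_lt_of_le Nat.zero_lt_one hi)
  simp only [Finset.mem_filter, Finset.mem_univ, true_and] at hj
  -- The leaves needed number `4 * (s + 1) + 2 * (t + 1) + 9`, at most `6 * s + 15` because `t ≤ s`.
  refine bob_wins_lollipop' hk hk0 (by omega) hodd hab (isLollipop_armFun hst h j) ?_ ha hb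
    (hf.mono (by omega))
  rintro (_ | i) _ _
  · exact hh
  · exact hj _

/-- Bob wins, with Alice to move, when two adjacent uncolored hubs see a common color. -/
theorem bob_wins_two_hubs (hk : k ≤ 4) (hk0 : 0 < k) (hst : t + 3 ≤ s) (hodd : (s - t) % 2 = 1)
    {c : Core J s ⊕ Core J s × Fin L → Option (Fin k)} {x y : Fin 8} {a : Fin 4}
    (hxy : (coreGraph J s t).Adj (inl x) (inl y))
    (hx : c (inl (inl x)) = none) (hy : c (inl (inl y)) = none)
    (hi : ∀ h, Intact c h 4)
    (hxa : Sees (corona (coreGraph J s t) L) c (inl (inl x)) a)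
    (hya : Sees (corona (coreGraph J s t) L) c (inl (inl y)) a) (hf : Fresh c (6 * s + 18)) :
    ¬ AliceWinsFrom (corona (coreGraph J s t) L) k Player.alice c := by
  have hne : (inl (inl y) : Core J s ⊕ Core J s × Fin L) ≠ inl (inl x) :=
    fun h => hxy.ne (inl.inj h).symm
  refine not_aliceWinsFrom_alice hx ?_
  intro c₁ v g hm1 hv hleg hg hoth
  have hns := not_sees_of_legal hk hleg
  have hf1 : Fresh c₁ (6 * s + 17) := hf.move hm1
  have hi1 : ∀ h, Intact c₁ h 3 := fun h => (hi h).move hm1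
  by_cases hvx : v = inl (inl x)
  -- A color put on one hub differs from `a`, so the other hub now sees two colors.
  · subst hvx
    exact bob_wins_hub hk hk0 hst hodd (a := a) (b := Fin.castLE hk g)
      (by rintro rfl; exact hns hxa) (by rw [hoth _ hne, hy]) ((hi1 y).mono (by omega))
      (hya.move hm1) (sees_of_adj hk (x := inl (inl x)) hxy.symm hg) (hf1.mono (by omega))
  have hx1 : c₁ (inl (inl x)) = none := by rw [hoth _ (Ne.symm hvx), hx]
  by_cases hvy : v = inl (inl y)
  · subst hvy
    exact bob_wins_hub hk hk0 hst hodd (a := a) (b := Fin.castLE hk g)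
      (by rintro rfl; exact hns hya) hx1 ((hi1 x).mono (by omega))
      (hxa.move hm1) (sees_of_adj hk (x := inl (inl y)) hxy hg) (hf1.mono (by omega))
  have hy1 : c₁ (inl (inl y)) = none := by rw [hoth _ (Ne.symm hvy), hy]
  obtain ⟨b, hab⟩ : ∃ b, a ≠ b := (exists_ne a).imp fun _ h => h.symm
  -- Alice left both hubs uncolored. Once `x` sees `a` and `b`, her only way to rescue it is to
  -- color it, and then `y` sees two colors.
  refine bob_blocks hk0 hx1 hf1 b ?_
  intro c₂ hm2 hco2 hxb hf2
  have hi2 : ∀ h, Intact c₂ h 2 := fun h => (hi1 h).move hm2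
  refine not_aliceWinsFrom_alice (v := inl (inl x)) (by rw [hco2, hx1]) ?_
  intro c₃ v g hm3 hv hleg hg hoth
  have hns := not_sees_of_legal hk hleg
  have hf3 : Fresh c₃ (6 * s + 15) := hf2.move hm3
  have hi3 : ∀ h, Intact c₃ h 1 := fun h => (hi2 h).move hm3
  have hxa2 := (hxa.move hm1).move hm2
  by_cases hvx : v = inl (inl x)
  · subst hvx
    exact bob_wins_hub hk hk0 hst hodd (a := a) (b := Fin.castLE hk g)
      (by rintro rfl; exact hns hxa2) (by rw [hoth _ hne, hco2, hy1])
      (hi3 y) (((hya.move hm1).move hm2).move hm3)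
      (sees_of_adj hk (x := inl (inl x)) hxy.symm hg) hf3
  · exact bob_wins_hub hk hk0 hst hodd hab (by rw [hoth _ (Ne.symm hvx), hco2, hx1])
      (hi3 x) (hxa2.move hm3) (hxb.move hm3) hf3

/-- Bob, to move, wins when an uncolored hub with an uncolored adjacent hub sees a color. -/
theorem bob_wins_one_hub (hk : k ≤ 4) (hk0 : 0 < k) (hst : t + 3 ≤ s) (hodd : (s - t) % 2 = 1)
    {c : Core J s ⊕ Core J s × Fin L → Option (Fin k)} {x y : Fin 8} {a : Fin 4}
    (hxy : (coreGraph J s t).Adj (inl x) (inl y))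
    (hx : c (inl (inl x)) = none) (hy : c (inl (inl y)) = none) (hi : ∀ h, Intact c h 5)
    (hxa : Sees (corona (coreGraph J s t) L) c (inl (inl x)) a) (hf : Fresh c (6 * s + 19)) :
    ¬ AliceWinsFrom (corona (coreGraph J s t) L) k Player.bob c := by
  refine bob_blocks hk0 hy hf a ?_
  intro c' hm hco hs hf'
  exact bob_wins_two_hubs hk hk0 hst hodd hxy (by rw [hco, hx]) (by rw [hco, hy])
    (fun h => (hi h).move hm) (hxa.move hm) hs hf'

/-- Seven moves at most precede the use of `bob_wins_hub`, which asks for one intact arm and `6 * s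
+ 15` leaves; hence eight arms and `6 * s + 22` leaves. -/
theorem not_aliceWins_corona (hk : k ≤ 4) (hst : t + 3 ≤ s) (hodd : (s - t) % 2 = 1)
    (hJ : 8 ≤ J) (hL : 6 * s + 22 ≤ L) : ¬ AliceWins (corona (coreGraph J s t) L) k := by
  unfold AliceWins
  rcases Nat.eq_zero_or_pos k with rfl | hk0
  · refine not_aliceWinsFrom_alice (v := inl (inl 0)) rfl ?_
    intro c' x a
    exact a.elim0
  have hf0 : Fresh (fun _ : Core J s ⊕ Core J s × Fin L => (none : Option (Fin k)))
      (6 * s + 22) := fun v => by simpa using hL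
  have hi0 : ∀ h, Intact (fun _ : Core J s ⊕ Core J s × Fin L => (none : Option (Fin k))) h 8 :=
    fun h => by simpa [Intact] using hJ
  refine not_aliceWinsFrom_alice (v := inl (inl 0)) rfl ?_
  intro c₁ v g hm1 _ hleg hg hoth
  -- Alice's first move touches at most one half of the hub path; Bob plays on four consecutive
  -- uncolored hubs of the other.
  obtain ⟨o, ho, hun⟩ : ∃ o : ℕ, o ≤ 4 ∧ ∀ h : Fin 8, o ≤ h → (h : ℕ) < o + 4 →
      c₁ (inl (inl h)) = none := by
    by_cases hv : ∃ h : Fin 8, (h : ℕ) < 4 ∧ v = inl (inl h)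
    · obtain ⟨h, h1, rfl⟩ := hv
      refine ⟨4, le_rfl, fun h' h2 _ => hoth _ fun e => ?_⟩
      have : h' = h := inl.inj (inl.inj e)
      omega
    · exact ⟨0, by omega, fun h' _ h2 => hoth _ fun e => hv ⟨h', by omega, e.symm⟩⟩
  have hf1 : Fresh c₁ (6 * s + 21) := hf0.move hm1
  have hi1 : ∀ h, Intact c₁ h 7 := fun h => (hi0 h).move hm1
  obtain ⟨h₀, e0⟩ : ∃ h : Fin 8, (h : ℕ) = o := ⟨⟨o, by omega⟩, rfl⟩
  obtain ⟨h₁, e1⟩ : ∃ h : Fin 8, (h : ℕ) = o + 1 := ⟨⟨o + 1, by omega⟩, rfl⟩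
  obtain ⟨h₂, e2⟩ : ∃ h : Fin 8, (h : ℕ) = o + 2 := ⟨⟨o + 2, by omega⟩, rfl⟩
  obtain ⟨h₃, e3⟩ : ∃ h : Fin 8, (h : ℕ) = o + 3 := ⟨⟨o + 3, by omega⟩, rfl⟩
  have a01 : (coreGraph J s t).Adj (inl h₁) (inl h₀) := hub_adj (by omega)
  have a12 : (coreGraph J s t).Adj (inl h₂) (inl h₁) := hub_adj (by omega)
  have a23 : (coreGraph J s t).Adj (inl h₃) (inl h₂) := hub_adj (by omega)
  -- Whatever Alice answers, two adjacent uncolored hubs remain of which one sees a color: `h₂, h₃`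
  -- if she colors `h₁`, `h₁, h₀` if she colors `h₂`, and `h₁, h₂` otherwise.
  refine bob_blocks hk0 (hun h₁ (by omega) (by omega)) hf1 0 ?_
  intro c₂ hm2 hco2 hs2 hf2
  have hi2 : ∀ h, Intact c₂ h 6 := fun h => (hi1 h).move hm2
  have hun2 : ∀ h : Fin 8, o ≤ h → (h : ℕ) < o + 4 → c₂ (inl (inl h)) = none :=
    fun h h1 h2 => by rw [hco2, hun h h1 h2]
  refine not_aliceWinsFrom_alice (hun2 h₁ (by omega) (by omega)) ?_
  intro c₃ v g hm3 _ hleg hg hoth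
  have hf3 : Fresh c₃ (6 * s + 19) := hf2.move hm3
  have hi3 : ∀ h, Intact c₃ h 5 := fun h => (hi2 h).move hm3
  have hun3 : ∀ h : Fin 8, o ≤ h → (h : ℕ) < o + 4 → v ≠ inl (inl h) →
      c₃ (inl (inl h)) = none :=
    fun h h1 h2 h3 => by rw [hoth _ h3.symm, hun2 h h1 h2]
  have hinj : ∀ h h' : Fin 8, (h : ℕ) ≠ h' →
      (inl (inl h) : Core J s ⊕ Core J s × Fin L) ≠ inl (inl h') :=
    fun h h' hne e => hne (by rw [inl.inj (inl.inj e)])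
  by_cases hv1 : v = inl (inl h₁)
  · subst hv1
    exact bob_wins_one_hub hk hk0 hst hodd a23.symm
      (hun3 h₂ (by omega) (by omega) (hinj _ _ (by omega)))
      (hun3 h₃ (by omega) (by omega) (hinj _ _ (by omega))) hi3
      (sees_of_adj hk (x := inl (inl h₁)) a12 hg) hf3
  have hc1 := hun3 h₁ (by omega) (by omega) hv1
  by_cases hv2 : v = inl (inl h₂)
  · subst hv2
    exact bob_wins_one_hub hk hk0 hst hodd a01 hc1
      (hun3 h₀ (by omega) (by omega) (hinj _ _ (by omega))) hi3 (hs2.move hm3) hf3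
  · exact bob_wins_one_hub hk hk0 hst hodd a12.symm hc1
      (hun3 h₂ (by omega) (by omega) hv2) hi3 (hs2.move hm3) hf3

end Construction

open Relation

/-! ### Alice's strategy with five colors on a forest plus a matching -/

section ForestMatching

variable {V : Type*} {k : ℕ} {Par : V → V → Prop}

/-- A vertex is active when it is colored or has a colored descendant. -/
def Active (Par : V → V → Prop) (c : V → Option (Fin k)) (v : V) : Prop :=
  ∃ w, c w ≠ none ∧ ReflTransGen Par w v

/-- Every uncolored vertex has at most one active child. -/
def Guarded (Par : V → V → Prop) (c : V → Option (Fin k)) : Prop :=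
  ∀ v u u', c v = none → Par u v → Par u' v → Active Par c u → Active Par c u' → u = u'

lemma Active.parent {c : V → Option (Fin k)} {u v : V} (h : Active Par c u)
    (huv : ReflTransGen Par u v) : Active Par c v := by
  obtain ⟨w, h1, h2⟩ := h
  exact ⟨w, h1, h2.trans huv⟩

/-- A position that arises from a guarded one by coloring at most the vertex `x`. -/
structure NearlyGuarded (Par : V → V → Prop) (c₀ c : V → Option (Fin k)) (x : V) : Prop where
  guarded : Guarded Par c₀
  colored : ∀ u, c₀ u ≠ none → c u ≠ none
  new : ∀ u, c u ≠ none → c₀ u ≠ none ∨ u = x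

lemma NearlyGuarded.active {c₀ c : V → Option (Fin k)} {x u : V} (h : NearlyGuarded Par c₀ c x)
    (hu : Active Par c u) : Active Par c₀ u ∨ ReflTransGen Par x u := by
  obtain ⟨w, h1, h2⟩ := hu
  rcases h.new w h1 with h3 | rfl
  · exact Or.inl ⟨w, h3, h2⟩
  · exact Or.inr h2

variable {rank : V → ℕ}

lemma rank_le_of_reflTransGen (hrank : ∀ u v, Par u v → rank v < rank u) {u v : V}
    (h : ReflTransGen Par u v) : rank v ≤ rank u := by
  induction h with
  | refl => exact le_rfl
  | tail _ h ih => exact (hrank _ _ h).le.trans ih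

/-- The ancestors of `x` form a chain along which the rank drops, so at most one child of `v` lies
on it. -/
lemma siblings_eq (hPar : ∀ v u u', Par v u → Par v u' → u = u')
    (hrank : ∀ u v, Par u v → rank v < rank u) {x u u' v : V} (h : ReflTransGen Par x u)
    (h' : ReflTransGen Par x u') (hu : Par u v) (hu' : Par u' v) : u = u' := by
  have key : ∀ u u', Par u v → Par u' v → ReflTransGen Par u u' → u = u' := by
    intro u u' hu hu' h
    rcases h.cases_head with h | ⟨w, hw, h⟩
    · exact h
    · rw [hPar u w v hw hu] at h
      have := rank_le_of_reflTransGen hrank h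
      have := hrank _ _ hu'
      omega
  rcases ReflTransGen.total_of_right_unique (fun v u u' => hPar v u u') h h' with h | h
  · exact key _ _ hu hu' h
  · exact (key _ _ hu' hu h).symm

lemma exists_legal_color {G : SimpleGraph V} [Finite V] {M : V → V → Prop}
    (hPar : ∀ v u u', Par v u → Par v u' → u = u')
    (hrank : ∀ u v, Par u v → rank v < rank u)
    (hM : ∀ v u u', M v u → M v u' → u = u')
    (hadj : ∀ u v, G.Adj u v → Par u v ∨ Par v u ∨ M u v)
    {c₀ c : V → Option (Fin 5)} {x v : V} (h : NearlyGuarded Par c₀ c x) (hv : c v = none) :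
    ∃ a, ∀ w, G.Adj v w → c w ≠ some a := by
  classical
  have := Fintype.ofFinite V
  have hv₀ : c₀ v = none := by
    by_contra hne
    exact h.colored v hne hv
  -- Four sets of at most one vertex cover the colored neighbors: the parent, the matching partner,
  -- the child active before the last move, and the child above the new vertex `x`.
  let S₁ : Finset V := Finset.univ.filter fun w => Par v w
  let S₂ : Finset V := Finset.univ.filter fun w => M v w
  let S₃ : Finset V := Finset.univ.filter fun w => Par w v ∧ Active Par c₀ w
  let S₄ : Finset V := Finset.univ.filter fun w => Par w v ∧ ReflTransGen Par x w
  have h1 : S₁.card ≤ 1 := Finset.card_le_one.mpr fun a ha b hb => by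
    simp only [S₁, Finset.mem_filter, Finset.mem_univ, true_and] at ha hb
    exact hPar v a b ha hb
  have h2 : S₂.card ≤ 1 := Finset.card_le_one.mpr fun a ha b hb => by
    simp only [S₂, Finset.mem_filter, Finset.mem_univ, true_and] at ha hb
    exact hM v a b ha hb
  have h3 : S₃.card ≤ 1 := Finset.card_le_one.mpr fun a ha b hb => by
    simp only [S₃, Finset.mem_filter, Finset.mem_univ, true_and] at ha hb
    exact h.guarded v a b hv₀ ha.1 hb.1 ha.2 hb.2
  have h4 : S₄.card ≤ 1 := Finset.card_le_one.mpr fun a ha b hb => by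
    simp only [S₄, Finset.mem_filter, Finset.mem_univ, true_and] at ha hb
    exact siblings_eq hPar hrank ha.2 hb.2 ha.1 hb.1
  let S : Finset V := (S₁ ∪ S₂) ∪ (S₃ ∪ S₄)
  have hS : S.card ≤ 4 := by
    have e1 := Finset.card_union_le (S₁ ∪ S₂) (S₃ ∪ S₄)
    have e2 := Finset.card_union_le S₁ S₂
    have e3 := Finset.card_union_le S₃ S₄
    change ((S₁ ∪ S₂) ∪ (S₃ ∪ S₄)).card ≤ 4
    omega
  have hmem : ∀ w, G.Adj v w → c w ≠ none → w ∈ S := by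
    intro w hw hc
    simp only [S, S₁, S₂, S₃, S₄, Finset.mem_union, Finset.mem_filter, Finset.mem_univ, true_and]
    rcases hadj v w hw with h' | h' | h'
    · exact Or.inl (Or.inl h')
    · rcases h.active ⟨w, hc, ReflTransGen.refl⟩ with h'' | h''
      · exact Or.inr (Or.inl ⟨h', h''⟩)
      · exact Or.inr (Or.inr ⟨h', h''⟩)
    · exact Or.inl (Or.inr h')
  obtain ⟨a, ha', ha⟩ : ∃ a ∈ (Finset.univ : Finset (Fin 5)).image some, a ∉ S.image c := by
    refine Finset.exists_mem_notMem_of_card_lt_card ?_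
    rw [Finset.card_image_of_injective _ (Option.some_injective _), Finset.card_univ,
      Fintype.card_fin]
    exact (Finset.card_image_le.trans hS).trans_lt (by norm_num)
  obtain ⟨b, -, rfl⟩ := Finset.mem_image.mp ha'
  refine ⟨b, fun w hw hc => ha (Finset.mem_image.mpr ⟨w, hmem w hw (by simp [hc]), hc⟩)⟩

/-- A vertex with two active children in a nearly guarded position. -/
lemma NearlyGuarded.violation (hPar : ∀ v u u', Par v u → Par v u' → u = u')
    (hrank : ∀ u v, Par u v → rank v < rank u)
    {c₀ c : V → Option (Fin k)} {x v u u' : V} (h : NearlyGuarded Par c₀ c x) (hv : c v = none)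
    (hne : u ≠ u') (hu : Par u v) (hu' : Par u' v) (ha : Active Par c u)
    (ha' : Active Par c u') :
    Active Par c₀ v ∧ ∃ w, Par w v ∧ ReflTransGen Par x w ∧ ¬ Active Par c₀ w := by
  have hv₀ : c₀ v = none := by
    by_contra hne
    exact h.colored v hne hv
  by_cases h1 : Active Par c₀ u
  · have h2 : ¬ Active Par c₀ u' := fun h2 => hne (h.guarded v u u' hv₀ hu hu' h1 h2)
    exact ⟨h1.parent (ReflTransGen.single hu), u', hu', (h.active ha').resolve_left h2, h2⟩
  · have h3 := (h.active ha).resolve_left h1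
    rcases h.active ha' with h2 | h2
    · exact ⟨h2.parent (ReflTransGen.single hu'), u, hu, h3, h1⟩
    · exact absurd (siblings_eq hPar hrank h3 h2 hu hu') hne

/-- Alice's choice: the vertex with two active children if there is one, else an active uncolored
vertex, else an uncolored vertex of least rank. -/
lemma exists_guarding_vertex (hPar : ∀ v u u', Par v u → Par v u' → u = u')
    (hrank : ∀ u v, Par u v → rank v < rank u)
    {c₀ c : V → Option (Fin k)} {x : V} (h : NearlyGuarded Par c₀ c x) (hex : ∃ v, c v = none) :
    ∃ v, c v = none ∧ ∀ c' : V → Option (Fin k), c' v ≠ none → (∀ u, u ≠ v → c' u = c u) →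
      Guarded Par c' := by
  have hU : Relator.RightUnique Par := fun v u u' => hPar v u u'
  -- coloring an active vertex does not change the set of active vertices
  have hact : ∀ (v : V) (c' : V → Option (Fin k)), Active Par c v → (∀ u, u ≠ v → c' u = c u) →
      ∀ u, Active Par c' u → Active Par c u := by
    rintro v c' hv hoth u ⟨w, h1, h2⟩
    by_cases hwv : w = v
    · subst hwv
      exact hv.parent h2
    · exact ⟨w, by rwa [← hoth w hwv], h2⟩
  by_cases hbad : ∃ v u u', c v = none ∧ u ≠ u' ∧ Par u v ∧ Par u' v ∧ Active Par c u ∧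
      Active Par c u'
  · obtain ⟨v, u, u', hv, hne, hu, hu', ha, ha'⟩ := hbad
    refine ⟨v, hv, fun c' hc' hoth z w w' hz hw hw' hb hb' => ?_⟩
    by_contra hww
    have hzv : z ≠ v := by
      rintro rfl
      exact hc' hz
    have hav := ha.parent (ReflTransGen.single hu)
    obtain ⟨e1, y, e2, e3, e4⟩ := h.violation hPar hrank hv hne hu hu' ha ha'
    obtain ⟨f1, y', f2, f3, f4⟩ := h.violation hPar hrank (by rwa [← hoth z hzv]) hww hw hw'
      (hact v c' hav hoth _ hb) (hact v c' hav hoth _ hb')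
    -- A violated vertex is the first one on the chain of ancestors of `x` that was active before.
    -- Comparing two of them both ways shows that they coincide.
    have key : ∀ {v z y y'}, Active Par c₀ v → Par y v → ReflTransGen Par x y → Par y' z →
        ReflTransGen Par x y' → ¬ Active Par c₀ y' → ReflTransGen Par z v := by
      intro v z y y' e1 e2 e3 f2 f3 f4
      rcases ReflTransGen.total_of_right_unique hU f3 (e3.tail e2) with h | h
      · rcases h.cases_head with rfl | ⟨q, hq, h⟩
        · exact absurd e1 f4
        · rwa [hPar _ _ _ hq f2] at h
      · exact absurd (e1.parent h) f4
    have g1 := key e1 e2 e3 f2 f3 f4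
    have g2 := key f1 f2 f3 e2 e3 e4
    rcases g1.cases_head with h | ⟨q, hq, h⟩
    · exact hzv h
    · have := rank_le_of_reflTransGen hrank h
      have := rank_le_of_reflTransGen hrank g2
      have := hrank _ _ hq
      omega
  · have hG : Guarded Par c := fun v u u' hv hu hu' ha ha' => by
      by_contra hne
      exact hbad ⟨v, u, u', hv, hne, hu, hu', ha, ha'⟩
    by_cases hua : ∃ v, c v = none ∧ Active Par c v
    · obtain ⟨v, hv, hav⟩ := hua
      refine ⟨v, hv, fun c' hc' hoth z w w' hz hw hw' hb hb' => ?_⟩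
      have hzv : z ≠ v := by
        rintro rfl
        exact hc' hz
      exact hG z w w' (by rwa [← hoth z hzv]) hw hw' (hact v c' hav hoth _ hb)
        (hact v c' hav hoth _ hb')
    -- The only vertices that become active are `v` and its ancestors, and by minimality the proper
    -- ancestors are colored.
    · obtain ⟨v, hv, hmin⟩ := exists_minimalFor_of_wellFoundedLT (fun v => c v = none) rank hex
      refine ⟨v, hv, fun c' hc' hoth z w w' hz hw hw' hb hb' => ?_⟩
      exfalso
      have hzv : z ≠ v := by
        rintro rfl
        exact hc' hz
      have hz' : c z = none := by rwa [← hoth z hzv]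
      refine hua ⟨z, hz', ?_⟩
      obtain ⟨y, h1, h2⟩ := hb
      by_cases hyv : y = v
      · subst hyv
        exfalso
        have h3 : ReflTransGen Par y z := h2.tail hw
        rcases h3.cases_head with h | ⟨q, hq, h⟩
        · exact hzv h.symm
        · have hqr := rank_le_of_reflTransGen hrank h
          have := hrank _ _ hq
          have := hmin hz' (by omega)
          omega
      · exact ⟨y, by rwa [← hoth y hyv], h2.tail hw⟩

/-- If the edges of a graph are covered by a rooted forest and a matching, then Alice wins the
coloring game with five colors. -/
theorem aliceWins_five [Finite V] {G : SimpleGraph V} {M : V → V → Prop}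
    (hPar : ∀ v u u', Par v u → Par v u' → u = u')
    (hrank : ∀ u v, Par u v → rank v < rank u)
    (hM : ∀ v u u', M v u → M v u' → u = u')
    (hadj : ∀ u v, G.Adj u v → Par u v ∨ Par v u ∨ M u v) : AliceWins G 5 := by
  classical
  have := Fintype.ofFinite V
  have alice : ∀ (n : ℕ) (c₀ c : V → Option (Fin 5)) (x : V), NearlyGuarded Par c₀ c x →
      (Finset.univ.filter fun v => c v = none).card = n →
      AliceWinsFrom G 5 Player.alice c := by
    intro n
    induction n using Nat.strong_induction_on with
    | _ n ih =>
    intro c₀ c x h hn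
    have hless : ∀ {c c' : V → Option (Fin 5)} {v}, c v = none → c' v ≠ none →
        (∀ u, u ≠ v → c' u = c u) → (Finset.univ.filter fun v => c' v = none).card <
          (Finset.univ.filter fun v => c v = none).card := by
      intro c c' v h1 h2 h3
      refine Finset.card_lt_card ⟨fun u hu => ?_, fun hsub => ?_⟩
      · simp only [Finset.mem_filter, Finset.mem_univ, true_and] at hu ⊢
        rwa [← h3 u (by rintro rfl; exact h2 hu)]
      · have : v ∈ Finset.univ.filter fun v => c' v = none := hsub (by simp [h1])
        exact h2 (by simpa using this)
    by_cases hex : ∃ v, c v = none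
    swap
    · exact .done _ _ fun v hv => hex ⟨v, hv⟩
    obtain ⟨v, hv, hgu⟩ := exists_guarding_vertex hPar hrank h hex
    obtain ⟨a, ha⟩ := exists_legal_color hPar hrank hM hadj h hv
    obtain ⟨c₁, hm₁, h1, h2⟩ := exists_gameMove hv ha
    have hg₁ := hgu c₁ (by simp [h1]) h2
    have hlt₁ := hless hv (by simp [h1]) h2
    refine .aliceMove c c₁ hm₁ ?_
    by_cases hex₁ : ∃ v, c₁ v = none
    swap
    · exact .done _ _ fun v hv => hex₁ ⟨v, hv⟩
    obtain ⟨v₁, hv₁⟩ := hex₁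
    refine .bobMove c₁ ?_ fun c₂ hm₂ => ?_
    · obtain ⟨a, ha⟩ := exists_legal_color (x := v) hPar hrank hM hadj
        ⟨hg₁, fun u hu => hu, fun u hu => Or.inl hu⟩ hv₁
      obtain ⟨c₂, hm₂, -⟩ := exists_gameMove hv₁ ha
      exact ⟨c₂, hm₂⟩
    · obtain ⟨y, b, e1, e2, e3, e4⟩ := gameMove_spec hm₂
      have hlt₂ := hless e1 (by simp [e3]) e4
      refine ih _ (by omega) c₁ c₂ y ⟨hg₁, fun u hu => ?_, fun u hu => ?_⟩ rfl
      · rwa [e4 u (by rintro rfl; exact hu e1)]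
      · by_cases huy : u = y
        · exact Or.inr huy
        · exact Or.inl (by rwa [← e4 u huy])
  rcases isEmpty_or_nonempty V with hV | ⟨⟨x⟩⟩
  · exact .done _ _ fun v => hV.elim v
  · refine alice _ (fun _ => none) _ x ⟨?_, fun u hu => hu, fun u hu => Or.inl hu⟩ rfl
    rintro v u u' - - - ⟨w, hw, -⟩
    exact absurd rfl hw

end ForestMatching

open SimpleGraph

/-! ### The spanning tree, the cycles, the girth and the cycle-distance -/

section Cactus

variable {J s t L : ℕ}

/-- A path of hubs with lollipops and pendant vertices attached. -/
abbrev cactus (J s t L : ℕ) : SimpleGraph (Core J s ⊕ Core J s × Fin L) :=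
  corona (coreGraph J s t) L

/-- The second vertex is the parent of the first one in the spanning tree. -/
def TreeParent : Core J s ⊕ Core J s × Fin L → Core J s ⊕ Core J s × Fin L → Prop
  | inl u, inl v => CoreParent u v
  | inr (u, _), inl v => u = v
  | _, inr _ => False

/-- The two vertices are joined by an edge outside the spanning tree. -/
def TreeChord (t : ℕ) : Core J s ⊕ Core J s × Fin L → Core J s ⊕ Core J s × Fin L → Prop
  | inl u, inl v => CoreChord t u v ∨ CoreChord t v u
  | _, _ => False

/-- A linear extension of the order of the spanning tree. -/
def treeRank : Core J s ⊕ Core J s × Fin L → ℕ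
  | inl (inl h) => h
  | inl (inr (_, _, i)) => 8 + i
  | inr _ => 8 + s

lemma treeParent_unique (v u u' : Core J s ⊕ Core J s × Fin L) (h : TreeParent v u)
    (h' : TreeParent v u') : u = u' := by
  rcases v with (v | ⟨v, j, i⟩) | ⟨v, l⟩ <;> rcases u with (u | ⟨u, ju, iu⟩) | ⟨u, lu⟩ <;>
    rcases u' with (w | ⟨w, jw, iw⟩) | ⟨w, lw⟩ <;>
    simp only [TreeParent, CoreParent] at h h'
  · congr 2; omega
  · rw [← h.1, ← h'.1]
  · omega
  · omega
  · obtain ⟨rfl, rfl, h⟩ := h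
    obtain ⟨rfl, rfl, h'⟩ := h'
    have : iu = iw := Fin.ext (by omega)
    rw [this]
  all_goals rw [← h, ← h']

lemma treeRank_lt (u v : Core J s ⊕ Core J s × Fin L) (h : TreeParent u v) :
    treeRank v < treeRank u := by
  rcases v with (v | ⟨v, j, i⟩) | ⟨v, l⟩ <;> rcases u with (u | ⟨u, ju, iu⟩) | ⟨u, lu⟩ <;>
    simp only [TreeParent, CoreParent, treeRank] at h ⊢ <;> omega

lemma treeChord_unique (hst : t + 3 ≤ s) (v u u' : Core J s ⊕ Core J s × Fin L)
    (h : TreeChord t v u) (h' : TreeChord t v u') : u = u' := by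
  rcases v with (v | ⟨v, j, i⟩) | ⟨v, l⟩ <;> rcases u with (u | ⟨u, ju, iu⟩) | ⟨u, lu⟩ <;>
    rcases u' with (w | ⟨w, jw, iw⟩) | ⟨w, lw⟩ <;>
    simp only [TreeChord, CoreChord, or_self] at h h'
  have e1 : u = w := by rcases h with h | h <;> rcases h' with h' | h' <;> omega
  have e2 : ju = jw := by
    rcases h with ⟨-, h, -⟩ | ⟨-, h, -⟩ <;> rcases h' with ⟨-, h', -⟩ | ⟨-, h', -⟩ <;> simp_all
  have e3 : iu = iw := Fin.ext (by rcases h with h | h <;> rcases h' with h' | h' <;> omega)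
  rw [e1, e2, e3]

lemma cactus_adj {u v : Core J s ⊕ Core J s × Fin L} (h : (cactus J s t L).Adj u v) :
    TreeParent u v ∨ TreeParent v u ∨ TreeChord t u v := by
  rcases u with u | ⟨u, l⟩ <;> rcases v with v | ⟨v, l'⟩
  · obtain ⟨-, h⟩ := coreGraph_adj.mp (show (coreGraph J s t).Adj u v from h)
    simp only [TreeParent, TreeChord]
    tauto
  · exact Or.inr (Or.inl (Eq.symm h))
  · exact Or.inl h
  · exact h.elim

theorem aliceWins_cactus (hst : t + 3 ≤ s) : AliceWins (cactus J s t L) 5 :=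
  aliceWins_five treeParent_unique treeRank_lt (treeChord_unique hst) (fun _ _ => cactus_adj)

/-- A vertex of an arm. -/
abbrev armVertex (L : ℕ) (h : Fin 8) (j : Fin J) (i : Fin s) : Core J s ⊕ Core J s × Fin L :=
  inl (inr (h, j, i))

lemma armVertex_adj {h : Fin 8} {j : Fin J} {i : Fin s} {w : Core J s ⊕ Core J s × Fin L}
    (ha : (cactus J s t L).Adj (armVertex L h j i) w) :
    (∃ x, w = inr x) ∨ (w = inl (inl h) ∧ (i : ℕ) = 0) ∨ ∃ i', w = armVertex L h j i' ∧
      ((i : ℕ) = i' + 1 ∨ (i' : ℕ) = i + 1 ∨ ((i : ℕ) = t ∧ (i' : ℕ) + 1 = s) ∨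
        ((i' : ℕ) = t ∧ (i : ℕ) + 1 = s)) := by
  have := cactus_adj ha
  rcases w with (w | ⟨w, j', i'⟩) | x
  · simp only [TreeParent, CoreParent, TreeChord, CoreChord, or_self, or_false] at this
    exact Or.inr (Or.inl ⟨by rw [this.1], this.2⟩)
  · simp only [TreeParent, CoreParent, TreeChord, CoreChord] at this
    obtain ⟨rfl, rfl⟩ : h = w ∧ j = j' := by
      rcases this with this | this | this | this <;> exact ⟨by omega, by simp_all⟩
    refine Or.inr (Or.inr ⟨i', rfl, ?_⟩)
    omega
  · exact Or.inl ⟨x, rfl⟩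

lemma armVertex_adj_succ {h : Fin 8} {j : Fin J} {i i' : Fin s} (hi : (i : ℕ) = i' + 1) :
    (cactus J s t L).Adj (armVertex L h j i) (armVertex L h j i') := by
  refine coreGraph_adj.mpr ⟨fun e => ?_, Or.inl ⟨rfl, rfl, hi⟩⟩
  have := (Prod.ext_iff.mp (Prod.ext_iff.mp (inr.inj e)).2).2
  simp only at this
  omega

lemma armVertex_adj_chord (hst : t + 3 ≤ s) {h : Fin 8} {j : Fin J} {i i' : Fin s}
    (hi : (i : ℕ) = t) (hi' : (i' : ℕ) + 1 = s) :
    (cactus J s t L).Adj (armVertex L h j i) (armVertex L h j i') := by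
  refine coreGraph_adj.mpr ⟨fun e => ?_, Or.inr (Or.inl ⟨rfl, rfl, hi, hi'⟩)⟩
  have := (Prod.ext_iff.mp (Prod.ext_iff.mp (inr.inj e)).2).2
  simp only at this
  omega

lemma armVertex_injective {h : Fin 8} {j : Fin J} : Function.Injective (armVertex (s := s) L h j) :=
  fun _ _ e => (Prod.ext_iff.mp (Prod.ext_iff.mp (inr.inj (inl.inj e))).2).2

/-- The vertices of the cycle of an arm. -/
def ring (t L : ℕ) (h : Fin 8) (j : Fin J) : Set (Core J s ⊕ Core J s × Fin L) :=
  {x | ∃ i : Fin s, t ≤ i ∧ x = armVertex L h j i}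

lemma walk_mem_of_closed {V : Type*} {G : SimpleGraph V} {S : Set V} {a b : V} (q : G.Walk a b)
    (hS : ∀ x y, s(x, y) ∈ q.edges → x ∈ S → y ∈ S) {x : V} (hx : x ∈ q.support) (hxS : x ∈ S) :
    ∀ y ∈ q.support, y ∈ S := by
  have key : ∀ {a b : V} (q : G.Walk a b), (∀ x y, s(x, y) ∈ q.edges → x ∈ S → y ∈ S) →
      ∀ y ∈ q.support, (y ∈ S ↔ a ∈ S) := by
    intro a b q
    induction q with
    | nil =>
      intro _ y hy
      rw [Walk.support_nil, List.mem_singleton] at hy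
      rw [hy]
    | cons hab q ih =>
      intro hS y hy
      rw [Walk.support_cons, List.mem_cons] at hy
      rcases hy with rfl | hy
      · rfl
      · rw [ih (fun x y h => hS x y (by simp [h])) y hy]
        exact ⟨hS _ _ (by rw [Sym2.eq_swap]; simp), hS _ _ (by simp)⟩
  intro y hy
  exact (key q hS y hy).mpr ((key q hS x hx).mp hxS)

/-- The only cycles are the cycles of the arms. -/
theorem toSubgraph_eq_ring (hst : t + 3 ≤ s) {u : Core J s ⊕ Core J s × Fin L}
    {p : (cactus J s t L).Walk u u} (hp : p.IsCycle) :
    ∃ (h : Fin 8) (j : Fin J),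
      p.toSubgraph = (⊤ : (cactus J s t L).Subgraph).induce (ring t L h j) := by
  have hcard : ∀ v ∈ p.support, (p.toSubgraph.neighborSet v).ncard = 2 :=
    fun v hv => hp.ncard_neighborSet_toSubgraph_eq_two hv
  have hmem : ∀ {v w}, p.toSubgraph.Adj v w → w ∈ p.support := fun h =>
    (Walk.mem_verts_toSubgraph p).mp h.snd_mem
  have other : ∀ v ∈ p.support, ∀ q, ∃ w, w ≠ q ∧ p.toSubgraph.Adj v w := by
    intro v hv q
    obtain ⟨a, b, hab, hset⟩ := Set.ncard_eq_two.mp (hcard v hv)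
    have ha : p.toSubgraph.Adj v a := by
      have : a ∈ p.toSubgraph.neighborSet v := by simp [hset]
      exact this
    have hb : p.toSubgraph.Adj v b := by
      have : b ∈ p.toSubgraph.neighborSet v := by simp [hset]
      exact this
    by_cases haq : a = q
    · exact ⟨b, fun h => hab (haq.trans h.symm), hb⟩
    · exact ⟨a, haq, ha⟩
  have hleaf : ∀ x, (inr x : Core J s ⊕ Core J s × Fin L) ∉ p.support := by
    rintro ⟨x, l⟩ hx
    obtain ⟨w, hw, hadj⟩ := other _ hx (inl x)
    have := hadj.adj_sub
    rcases w with w | w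
    · exact hw (congrArg inl (Eq.symm this))
    · exact this
  -- the cycle contains the end of an arm
  obtain ⟨h, j, e, he, hes⟩ : ∃ (h : Fin 8) (j : Fin J) (e : Fin s), (e : ℕ) + 1 = s ∧
      armVertex L h j e ∈ p.support := by
    -- A vertex of maximal rank on the cycle has no child there and only one parent, so one of its
    -- two cycle edges is a chord.
    obtain ⟨v, hv, hmax⟩ := Finset.exists_max_image p.support.toFinset treeRank
      ⟨u, by simp⟩
    simp only [List.mem_toFinset] at hv hmax
    have hnb : ∀ w, p.toSubgraph.Adj v w → TreeParent v w ∨ TreeChord t v w := by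
      intro w hw
      rcases cactus_adj hw.adj_sub with h | h | h
      · exact Or.inl h
      · have := treeRank_lt _ _ h
        have := hmax w (hmem hw)
        omega
      · exact Or.inr h
    obtain ⟨w, hw, hc⟩ : ∃ w ∈ p.support, TreeChord t v w := by
      obtain ⟨w, -, hw⟩ := other v hv v
      obtain ⟨w', hne, hw'⟩ := other v hv w
      rcases hnb w hw with h | h
      · rcases hnb w' hw' with h' | h'
        · exact absurd (treeParent_unique _ _ _ h' h) hne
        · exact ⟨w', hmem hw', h'⟩
      · exact ⟨w, hmem hw, h⟩
    rcases v with (v | ⟨v, j, i⟩) | ⟨v, l⟩ <;> rcases w with (w | ⟨w, j', i'⟩) | ⟨w, l'⟩ <;>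
      simp only [TreeChord, CoreChord, or_self] at hc
    rcases hc with hc | hc
    · exact ⟨_, _, i', hc.2.2.2, hw⟩
    · exact ⟨_, _, i, hc.2.2.2, hv⟩
  obtain ⟨r, hr⟩ : ∃ r : Fin s, (r : ℕ) = t := ⟨⟨t, by omega⟩, rfl⟩
  have hchord : p.toSubgraph.Adj (armVertex L h j e) (armVertex L h j r) := by
    obtain ⟨e', he'⟩ : ∃ e' : Fin s, (e' : ℕ) + 1 = e := ⟨⟨e - 1, by omega⟩, by
      change (e : ℕ) - 1 + 1 = e
      omega⟩
    obtain ⟨w, hw, hadj⟩ := other _ hes (armVertex L h j e')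
    rcases armVertex_adj hadj.adj_sub with ⟨x, rfl⟩ | ⟨-, h0⟩ | ⟨i', rfl, hi⟩
    · exact absurd (hmem hadj) (hleaf x)
    · omega
    · have : i' ≠ e' := by
        rintro rfl
        exact hw rfl
      have : i' = r := Fin.ext (by omega)
      rwa [this] at hadj
  -- From the end of the arm the cycle is forced down to index `t`: leaves are excluded and each
  -- vertex needs a second cycle neighbor.
  have hpath : ∀ (n : ℕ) (i i' : Fin s), (i : ℕ) + n + 1 = s → (i : ℕ) = i' + 1 → t ≤ i' →
      p.toSubgraph.Adj (armVertex L h j i) (armVertex L h j i') := by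
    intro n
    induction n with
    | zero =>
      intro i i' hi hii ht
      have : i = e := Fin.ext (by omega)
      subst this
      obtain ⟨w, hw, hadj⟩ := other _ hes (armVertex L h j r)
      rcases armVertex_adj hadj.adj_sub with ⟨x, rfl⟩ | ⟨-, h0⟩ | ⟨i'', rfl, hi⟩
      · exact absurd (hmem hadj) (hleaf x)
      · omega
      · have : i'' ≠ r := by
          rintro rfl
          exact hw rfl
        have : i'' = i' := Fin.ext (by omega)
        rwa [this] at hadj
    | succ n ih =>
      intro i i' hi hii ht
      obtain ⟨q, hq⟩ : ∃ q : Fin s, (q : ℕ) = i + 1 := ⟨⟨i + 1, by omega⟩, rfl⟩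
      have hqi := ih q i (by omega) hq (by omega)
      obtain ⟨w, hw, hadj⟩ := other _ (hmem hqi) (armVertex L h j q)
      rcases armVertex_adj hadj.adj_sub with ⟨x, rfl⟩ | ⟨-, h0⟩ | ⟨i'', rfl, hi⟩
      · exact absurd (hmem hadj) (hleaf x)
      · omega
      · have : i'' ≠ q := by
          rintro rfl
          exact hw rfl
        have : i'' = i' := Fin.ext (by omega)
        rwa [this] at hadj
  have hsupp : ∀ i : Fin s, t ≤ i → armVertex L h j i ∈ p.support := by
    intro i hi
    by_cases hie : (i : ℕ) + 1 = s
    · have : i = e := Fin.ext (by omega)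
      rwa [this]
    · exact hmem (hpath (s - (i + 2)) ⟨i + 1, by omega⟩ i
        (by change (i : ℕ) + 1 + (s - (i + 2)) + 1 = s; omega) rfl hi)
  have hring : ∀ y ∈ p.support, y ∈ ring t L h j := by
    refine walk_mem_of_closed p ?_ hes ⟨e, by omega, rfl⟩
    rintro x y hxy ⟨i, hi, rfl⟩
    have hadj : p.toSubgraph.Adj (armVertex L h j i) y := (Walk.mem_edges_toSubgraph p).mpr hxy
    by_cases hir : (i : ℕ) = t
    · have : i = r := Fin.ext (by omega)
      subst this
      obtain ⟨q, hq⟩ : ∃ q : Fin s, (q : ℕ) = i + 1 := ⟨⟨i + 1, by omega⟩, rfl⟩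
      have h1 : p.toSubgraph.Adj (armVertex L h j i) (armVertex L h j q) :=
        (hpath (s - (q + 1)) q i (by omega) hq hi).symm
      -- The attachment vertex has already used both its cycle edges, so the cycle cannot leave
      -- through the tail.
      obtain ⟨a, b, hab, hset⟩ := Set.ncard_eq_two.mp (hcard _ (hsupp i hi))
      have hin : ∀ w, p.toSubgraph.Adj (armVertex L h j i) w → w = a ∨ w = b := by
        intro w hw
        have : w ∈ p.toSubgraph.neighborSet (armVertex L h j i) := hw
        simpa [hset] using this
      have hqe : armVertex L h j q ≠ armVertex L h j e := fun h' => by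
        have := armVertex_injective h'
        omega
      have hy : y = armVertex L h j q ∨ y = armVertex L h j e := by
        rcases hin _ h1 with h1 | h1 <;> rcases hin _ hchord.symm with h2 | h2 <;>
          rcases hin _ hadj with h3 | h3
        · exact absurd (h1.trans h2.symm) hqe
        · exact absurd (h1.trans h2.symm) hqe
        · exact Or.inl (h3.trans h1.symm)
        · exact Or.inr (h3.trans h2.symm)
        · exact Or.inr (h3.trans h2.symm)
        · exact Or.inl (h3.trans h1.symm)
        · exact absurd (h1.trans h2.symm) hqe
        · exact absurd (h1.trans h2.symm) hqe
      rcases hy with rfl | rfl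
      · exact ⟨q, by omega, rfl⟩
      · exact ⟨e, by omega, rfl⟩
    · rcases armVertex_adj hadj.adj_sub with ⟨x, rfl⟩ | ⟨-, h0⟩ | ⟨i', rfl, hi'⟩
      · exact absurd (hmem hadj) (hleaf x)
      · omega
      · exact ⟨i', by omega, rfl⟩
  refine ⟨h, j, Subgraph.ext ?_ ?_⟩
  · ext x
    rw [Walk.mem_verts_toSubgraph]
    exact ⟨hring x, fun ⟨i, hi, hx⟩ => hx ▸ hsupp i hi⟩
  · ext x y
    rw [Subgraph.induce_adj, Subgraph.top_adj]
    refine ⟨fun hxy => ⟨hring x (hmem hxy.symm), hring y (hmem hxy), hxy.adj_sub⟩, ?_⟩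
    rintro ⟨⟨i, hi, rfl⟩, ⟨i', hi', rfl⟩, hadj⟩
    rcases armVertex_adj hadj with ⟨x, hx⟩ | ⟨hx, -⟩ | ⟨i'', hx, hc⟩
    · simp at hx
    · simp at hx
    · obtain rfl := armVertex_injective hx
      rcases hc with hc | hc | ⟨h1, h2⟩ | ⟨h1, h2⟩
      · exact hpath (s - (i + 1)) i i' (by omega) hc hi'
      · exact (hpath (s - (i' + 1)) i' i (by omega) hc hi).symm
      · have e1 : i = r := Fin.ext (by omega)
        have e2 : i' = e := Fin.ext (by omega)
        rw [e1, e2]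
        exact hchord.symm
      · have e1 : i' = r := Fin.ext (by omega)
        have e2 : i = e := Fin.ext (by omega)
        rw [e1, e2]
        exact hchord

lemma ring_disjoint {h h' : Fin 8} {j j' : Fin J} {x : Core J s ⊕ Core J s × Fin L}
    (hx : x ∈ ring t L h j) (hx' : x ∈ ring t L h' j') : h = h' ∧ j = j' := by
  obtain ⟨i, -, rfl⟩ := hx
  obtain ⟨i', -, e⟩ := hx'
  have := inr.inj (inl.inj e)
  simp only [Prod.mk.injEq] at this
  exact ⟨this.1, this.2.1⟩

theorem isCactus_cactus (hst : t + 3 ≤ s) : IsCactus (cactus J s t L) := by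
  rintro H₁ H₂ ⟨u₁, p₁, hp₁, rfl⟩ ⟨u₂, p₂, hp₂, rfl⟩ e he₁ he₂
  obtain ⟨h, j, e₁⟩ := toSubgraph_eq_ring hst hp₁
  obtain ⟨h', j', e₂⟩ := toSubgraph_eq_ring hst hp₂
  rw [e₁] at he₁
  rw [e₂] at he₂
  rw [e₁, e₂]
  induction e with
  | _ x y =>
    obtain ⟨rfl, rfl⟩ := ring_disjoint he₁.1 he₂.1
    rfl

/-- The arm still joins the ends of the chord when the chord is deleted, so some cycle runs through
it; by `toSubgraph_eq_ring` it can only be this ring. -/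
lemma isCycleSubgraph_ring (hst : t + 3 ≤ s) (h : Fin 8) (j : Fin J) :
    IsCycleSubgraph (cactus J s t L) ((⊤ : (cactus J s t L).Subgraph).induce (ring t L h j)) := by
  obtain ⟨r, hr⟩ : ∃ r : Fin s, (r : ℕ) = t := ⟨⟨t, by omega⟩, rfl⟩
  obtain ⟨e, he⟩ : ∃ e : Fin s, (e : ℕ) + 1 = s := ⟨⟨s - 1, by omega⟩, by
    change s - 1 + 1 = s
    omega⟩
  have hreach : ∀ (n : ℕ) (i : Fin s), (i : ℕ) = t + n → (cactus J s t L \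
      fromEdgeSet {s(armVertex L h j r, armVertex L h j e)}).Reachable
        (armVertex L h j r) (armVertex L h j i) := by
    intro n
    induction n with
    | zero =>
      intro i hi
      have : i = r := Fin.ext (by omega)
      rw [this]
    | succ n ih =>
      intro i hi
      obtain ⟨i', hi'⟩ : ∃ i' : Fin s, (i' : ℕ) = t + n := ⟨⟨t + n, by omega⟩, rfl⟩
      refine (ih i' hi').trans (Adj.reachable ?_)
      rw [sdiff_adj, fromEdgeSet_adj]
      refine ⟨(armVertex_adj_succ (by omega)).symm, fun hmem => ?_⟩
      rcases Sym2.eq_iff.mp (Set.mem_singleton_iff.mp hmem.1) with ⟨h1, h2⟩ | ⟨h1, h2⟩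
      · have := armVertex_injective h1
        have := armVertex_injective h2
        omega
      · have := armVertex_injective h1
        have := armVertex_injective h2
        omega
  obtain ⟨u, p, hp, hedge⟩ := adj_and_reachable_delete_edges_iff_exists_cycle.mp
    ⟨armVertex_adj_chord (t := t) hst hr he, hreach (s - 1 - t) e (by omega)⟩
  obtain ⟨h', j', hpr⟩ := toSubgraph_eq_ring hst hp
  have hrm : armVertex L h j r ∈ p.toSubgraph.verts :=
    (Walk.mem_verts_toSubgraph p).mpr (p.fst_mem_support_of_mem_edges hedge)
  rw [hpr] at hrm
  obtain ⟨rfl, rfl⟩ := ring_disjoint (⟨r, hr.ge, rfl⟩ : armVertex L h j r ∈ ring t L h j) hrm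
  exact ⟨u, p, hp, hpr⟩

theorem le_egirth_cactus (hst : t + 3 ≤ s) {n : ℕ} (hn : n + t + 1 ≤ s) :
    (n : ℕ∞) ≤ (cactus J s t L).egirth := by
  refine le_egirth.mpr fun u p hp => ?_
  obtain ⟨h, j, hpr⟩ := toSubgraph_eq_ring hst hp
  have hsub : (Finset.univ.filter fun i : Fin s => t ≤ i).image (armVertex L h j) ⊆
      p.support.toFinset := by
    intro x hx
    obtain ⟨i, hi, rfl⟩ := Finset.mem_image.mp hx
    rw [List.mem_toFinset, ← Walk.mem_verts_toSubgraph, hpr]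
    exact ⟨i, by simpa using hi, rfl⟩
  have h1 := Finset.card_le_card hsub
  rw [Finset.card_image_of_injective _ armVertex_injective] at h1
  have h2 := List.toFinset_card_le p.support
  rw [Walk.length_support] at h2
  have h3 : s - t ≤ (Finset.univ.filter fun i : Fin s => t ≤ i).card := by
    have : (Finset.univ : Finset (Fin (s - t))).card ≤
        (Finset.univ.filter fun i : Fin s => t ≤ i).card := by
      refine Finset.card_le_card_of_injOn (fun i => (⟨t + i, by omega⟩ : Fin s)) ?_ ?_
      · intro i _
        simp
      · intro i _ i' _ hii
        have := congrArg Fin.val hii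
        simp only at this
        exact Fin.ext (by omega)
    simpa using this
  exact_mod_cast (by omega : n ≤ p.length)

/-- The distance of a vertex from the hub along an arm, cut off at the cycle. -/
def height (t : ℕ) (h : Fin 8) (j : Fin J) : Core J s ⊕ Core J s × Fin L → ℕ
  | inl (inl _) => 0
  | inl (inr (h', j', i)) => if h' = h ∧ j' = j then min (i + 1) (t + 1) else 0
  | inr (inl _, _) => 0
  | inr (inr (h', j', i), _) => if h' = h ∧ j' = j then min (i + 1) (t + 1) else 0

/-- The cut-off gives both ends of a chord the same height, so heights change by at most one along
every edge. -/
lemma height_le_of_adj (hst : t + 3 ≤ s) (h : Fin 8) (j : Fin J)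
    {u v : Core J s ⊕ Core J s × Fin L} (ha : (cactus J s t L).Adj u v) :
    height t h j u ≤ height t h j v + 1 := by
  rcases u with (u | ⟨hu, ju, iu⟩) | ⟨u | ⟨hu, ju, iu⟩, l⟩ <;>
    rcases v with (v | ⟨hv, jv, iv⟩) | ⟨v | ⟨hv, jv, iv⟩, l'⟩ <;>
    have hc := cactus_adj ha <;>
    simp only [TreeParent, TreeChord, CoreParent, CoreChord, or_self, or_false, false_or, inl.injEq,
      inr.injEq, Prod.mk.injEq, reduceCtorEq] at hc <;>
    simp only [height] <;> try omega
  · split_ifs <;> omega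
  · obtain ⟨rfl, rfl⟩ : hu = hv ∧ ju = jv := by
      rcases hc with hc | hc | hc | hc <;> exact ⟨by omega, by simp_all⟩
    split_ifs <;> omega
  · obtain ⟨rfl, rfl, rfl⟩ := hc
    omega
  · obtain ⟨rfl, rfl, rfl⟩ := hc
    omega

lemma le_cycleDistance_cactus (hst : t + 3 ≤ s) : (t : ℕ∞) ≤ cycleDistance (cactus J s t L) := by
  refine le_sInf ?_
  rintro n ⟨H₁, H₂, ⟨u₁, p₁, hp₁, rfl⟩, ⟨u₂, p₂, hp₂, rfl⟩, hne, u, hu, v, hv, p, -, rfl⟩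
  obtain ⟨h, j, e₁⟩ := toSubgraph_eq_ring hst hp₁
  obtain ⟨h', j', e₂⟩ := toSubgraph_eq_ring hst hp₂
  rw [e₁] at hu hne
  rw [e₂] at hv hne
  obtain ⟨i, hi, rfl⟩ := hu
  obtain ⟨i', hi', rfl⟩ := hv
  have hlen : ∀ {u v : Core J s ⊕ Core J s × Fin L} (p : (cactus J s t L).Walk u v),
      height t h j u ≤ height t h j v + p.length := by
    intro u v p
    induction p with
    | nil => simp
    | cons ha p ih =>
      have := height_le_of_adj hst h j ha
      rw [Walk.length_cons]
      omega
  -- The height is `t + 1` on the ring of this arm and `0` on every other ring.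
  have := hlen p
  simp only [height] at this
  rw [if_pos (by simp), if_neg (by rintro ⟨rfl, rfl⟩; exact hne rfl)] at this
  exact_mod_cast (by omega : t ≤ p.length)

lemma armVertex_reachable_hub (h : Fin 8) (j : Fin J) : ∀ (n : ℕ) (i : Fin s), (i : ℕ) = n →
    (cactus J s t L).Reachable (armVertex L h j i) (inl (inl h)) := by
  intro n
  induction n with
  | zero =>
    intro i hi
    exact Adj.reachable (coreGraph_adj.mpr ⟨by simp, Or.inl ⟨rfl, hi⟩⟩)
  | succ n ih =>
    intro i hi
    obtain ⟨i', hi'⟩ : ∃ i' : Fin s, (i' : ℕ) = n := ⟨⟨n, by omega⟩, rfl⟩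
    exact (armVertex_adj_succ (by omega)).reachable.trans (ih i' hi')

lemma cycleDistance_cactus_ne_top (hst : t + 3 ≤ s) (hJ : 2 ≤ J) :
    cycleDistance (cactus J s t L) ≠ ⊤ := by
  classical
  obtain ⟨r, hr⟩ : ∃ r : Fin s, (r : ℕ) = t := ⟨⟨t, by omega⟩, rfl⟩
  have hm : ∀ j : Fin J, armVertex L 0 j r ∈ ring t L 0 j := fun j => ⟨r, hr.ge, rfl⟩
  obtain ⟨w⟩ := (armVertex_reachable_hub (t := t) (L := L) 0 (⟨0, by omega⟩ : Fin J) _ r rfl).trans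
    (armVertex_reachable_hub 0 (⟨1, by omega⟩ : Fin J) _ r rfl).symm
  refine ne_top_of_le_ne_top (ENat.natCast_ne_top w.bypass.length) (sInf_le ?_)
  refine ⟨_, _, isCycleSubgraph_ring hst 0 ⟨0, by omega⟩, isCycleSubgraph_ring hst 0 ⟨1, by omega⟩,
    fun heq => ?_, _, hm _, _, hm _, w.bypass, w.bypass_isPath, rfl⟩
  have h0 := hm ⟨0, by omega⟩
  have hverts := congrArg Subgraph.verts heq
  rw [Subgraph.induce_verts, Subgraph.induce_verts] at hverts
  rw [hverts] at h0
  have := (ring_disjoint h0 (hm _)).2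
  simp at this

lemma egirth_cactus_ne_top (hst : t + 3 ≤ s) (hJ : 0 < J) : (cactus J s t L).egirth ≠ ⊤ := by
  obtain ⟨u, p, hp, -⟩ := isCycleSubgraph_ring (L := L) hst 0 (⟨0, hJ⟩ : Fin J)
  rw [ne_eq, egirth_eq_top]
  exact fun hacyc => hacyc p hp

end Cactus
end ColoringGame

theorem theorem1 (d k : ℕ) :
    ∃ (V : Type) (_ : Finite V) (G : SimpleGraph V),
      IsCactus G ∧
      (k : ℕ∞) ≤ G.egirth ∧ G.egirth ≠ ⊤ ∧
      (d : ℕ∞) ≤ cycleDistance G ∧ cycleDistance G ≠ ⊤ ∧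
      gameChromaticNumber G = 5 := by
  -- Tails end at index `d`, and the cycles have the odd length `2 * k + 3`.
  have hst : d + 3 ≤ d + (2 * k + 3) := by omega
  refine ⟨_, inferInstance,
    ColoringGame.cactus 8 (d + (2 * k + 3)) d (6 * (d + (2 * k + 3)) + 22),
    ColoringGame.isCactus_cactus hst, ColoringGame.le_egirth_cactus hst (by omega),
    ColoringGame.egirth_cactus_ne_top hst (by norm_num),
    ColoringGame.le_cycleDistance_cactus hst,
    ColoringGame.cycleDistance_cactus_ne_top hst (by norm_num), ?_⟩
  refine le_antisymm (Nat.sInf_le (ColoringGame.aliceWins_cactus hst)) ?_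
  refine le_csInf ⟨5, ColoringGame.aliceWins_cactus hst⟩ fun n hn => ?_
  by_contra hlt
  exact ColoringGame.not_aliceWins_corona (by omega) hst (by omega) le_rfl le_rfl hn
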